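/- **The sketch.** Fix an integer $t\ge 0$ and a scale $c\in(1/2,1)$ (e.g. $c=2/3$). The sketch has an even capacity parameter $k$, a number $s$ of full-size levels, and a height $H$. In the KLL hierarchy of height $H$, the compactor at height $h\in\{0,\dots,H-1\}$ holds items of weight $2^h$ and has capacity $k_h=k$ if $h\ge H-s$, and $k_h=\max(kc^{H-h},2)$, rounded up to an even integer, otherwise. When a compactor reaches its capacity its items are sorted, the odd- or the even-indexed ones (each choice with probability $1/2$, independently) are passed to height $h+1$, and the others are discarded. For a stream of length $n$, $H$ is the height with which this KLL sketch terminates, i.e. the least $H\ge1$ such that the top compactor does not fill up on $n$ items. The lowest levels, those of capacity $2$, are implemented by a sampler: from each block of $2^g$ stream items ($g$ the number of these levels) it passes on one chosen uniformly at random; the currently selected item of an unfinished block counts with weight equal to the current length of the block. The top $t$ KLL compactors (more precisely, the top $t'=\min(t,H-1)$) are replaced by one *linear compactor* of capacity $t'k$. This is a list $C=\{(y_1,w_1),\dots,(y_m,w_m)\}$ with $y_1<\dots<y_m$, with rank function $$f_C(q)=\sum_{i<i^*}w_i+w_{i^*}\frac{q-y_{i^*-1}}{y_{i^*}-y_{i^*-1}},\qquad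 i^*=\min\{i:y_i>q\},$$ where $f_C(q)=0$ for $q<y_1$ and $f_C(q)=\sum_i w_i$ for $q\ge y_m$. Each batch of items passed on by the highest remaining KLL compactor is regarded as such a list, with all weights $2^{H-t'}$, and added to $C$: the point lists are merged, and the new weights are the finite differences, along the merged points, of the sum of the two rank functions. When the linear compactor reaches its capacity, $C$ is replaced by a list $C'$ of half as many points such that the points of $C'$ are points of $C$, the total weight is unchanged, $f_{C'}(x)=f_C(x)$ for every point $x$ of $C'$, and $\sup_{q\in\mathbb R}|f_C(q)-f_{C'}(q)|$ is minimal among all such lists (ties are broken arbitrarily). The estimate of the rank of $q$ is the total weight of the items $\le q$ stored in the sampler and the KLL compactors, plus $f_C(q)$. Space is counted in words, each holding a number or an item, after each stream item is processed: two for the sampler, one for each KLL compactor (above the sampler) and one for each item in it, and two for each element of the linear compactor. **Theorem.** Let $\ell(\delta)=\max(1,\log\log(1/\delta))$. For all $t\ge0$ and $c\in(1/2,1)$ there are constants $A,K,M>0$, depending only on $t$ and $c$, such that for all $\varepsilon,\delta\in(0,1)$, every optimal compaction rule for the linear compactor, and every stream $x_1,\dots,x_n$ of distinct real numbers, the sketch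 above with $k=2\lceil K\ell(\delta)/\varepsilon\rceil$ and $s=\lceil A\,\ell(\delta)\rceil$ has the following properties. 1. For every single query $q\in\mathbb R$, with probability at least $1-\delta$ the estimated rank of $q$ after the whole stream differs from the true rank $|\{i:x_i\le q\}|$ by at most $\varepsilon n$. 2. At every time during the stream, and for every outcome of the random choices, the sketch uses at most $M\cdot\frac1\varepsilon\,\ell(\delta)^2$ words of space, i.e. space $O\big((1/\varepsilon)\log^2\log(1/\delta)\big)$. -/

import Mathlib

open scoped ENNReal

noncomputable section

namespace LinearSketch

/-! ### Linear compactors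

A linear compactor is a list of pairs `(y, w)` (point, weight), listed by increasing points. -/

/-- The contribution at `q` of the points after `a`, where `a ≤ q` is the point just passed: the
weight of every further point `≤ q` counts fully, and the weight of the first point `y > q` counts
with the fraction `(q - a) / (y - a)`. -/
def interpFrom : ℝ → List (ℝ × ℝ) → ℝ → ℝ
  | _, [], _ => 0
  | a, (y, w) :: C, q => if y ≤ q then w + interpFrom y C q else w * ((q - a) / (y - a))

/-- The piecewise-linear rank function `f_C` of a linear compactor `C`:
`f_C q = ∑_{i < i*} w_i + w_{i*} (q - y_{i*-1}) / (y_{i*} - y_{i*-1})`, where `i*` is the smallest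
index with `y_{i*} > q`. It is `0` to the left of all points and the total weight to the right of
all points. -/
def linRank : List (ℝ × ℝ) → ℝ → ℝ
  | [], _ => 0
  | (y, w) :: C, q => if y ≤ q then w + interpFrom y C q else 0

/-- The finite differences of `g` along a list of points; `v` is the preceding value. -/
def finiteDiff (g : ℝ → ℝ) : ℝ → List ℝ → List (ℝ × ℝ)
  | _, [] => []
  | v, z :: zs => (z, g z - v) :: finiteDiff g (g z) zs

/-- Adding a set `ys` of new points, each of weight `w`, to a linear compactor `C`: the two point
lists are merged and sorted, the two rank functions are added, and the new weights are the
finite differences of the sum. -/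
def linAdd (C : List (ℝ × ℝ)) (w : ℝ) (ys : List ℝ) : List (ℝ × ℝ) :=
  finiteDiff
    (fun z => linRank C z + linRank ((ys.insertionSort (· ≤ ·)).map fun y => (y, w)) z) 0
    ((C.map Prod.fst ++ ys).insertionSort (· ≤ ·))

/-- `C'` is an admissible result of compacting `C`: it has half as many points, they are points of
`C`, the total weight is the same, and the rank of every retained point is unchanged. -/
structure IsCompaction (C C' : List (ℝ × ℝ)) : Prop where
  sublist : (C'.map Prod.fst).Sublist (C.map Prod.fst)
  length_eq : C'.length = C.length / 2
  weight_eq : (C'.map Prod.snd).sum = (C.map Prod.snd).sum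
  rank_eq : ∀ p ∈ C', linRank C' p.1 = linRank C p.1

/-- The supremum loss between the rank functions of two linear compactors. -/
def supLoss (C C' : List (ℝ × ℝ)) : ℝ≥0∞ :=
  ⨆ q : ℝ, ENNReal.ofReal |linRank C q - linRank C' q|

/-- `C'` is an admissible compaction of `C` with the smallest possible supremum loss. -/
def IsOptimalCompaction (C C' : List (ℝ × ℝ)) : Prop :=
  IsCompaction C C' ∧ ∀ C'', IsCompaction C C'' → supLoss C C' ≤ supLoss C C''

/-- A compaction rule for linear compactors is optimal if it returns an optimal compaction whenever
there is one (the rule is free to break ties between optimal compactions). -/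
def IsOptimalRule (compact : List (ℝ × ℝ) → List (ℝ × ℝ)) : Prop :=
  ∀ C, (∃ C', IsOptimalCompaction C C') → IsOptimalCompaction C (compact C)

/-! ### The KLL hierarchy -/

/-- The capacity of the KLL compactor at height `h` in a hierarchy of height `H`: the top `s`
compactors have capacity `k`, the one at a lower height `h` has capacity `max (k c^(H-h)) 2`,
rounded up to an even integer. -/
def capacity (k s : ℕ) (c : ℝ) (H h : ℕ) : ℕ :=
  if H ≤ h + s then k else 2 * ⌈max ((k : ℝ) * c ^ (H - h)) 2 / 2⌉₊

/-- The number of items that arrive at height `h` of the KLL sketch of height `H` while it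
processes `n` items: a compactor passes on half of its capacity whenever it is full. -/
def arrivals (k s : ℕ) (c : ℝ) (H n : ℕ) : ℕ → ℕ
  | 0 => n
  | h + 1 => capacity k s c H h / 2 * (arrivals k s c H n h / capacity k s c H h)

/-- The height with which the KLL sketch terminates on a stream of length `n`: the smallest
`H ≥ 1` such that the top compactor (at height `H - 1`) does not reach its capacity. -/
def kllHeight (k s : ℕ) (c : ℝ) (n : ℕ) : ℕ :=
  sInf {H | 1 ≤ H ∧ arrivals k s c H n (H - 1) < capacity k s c H (H - 1)}

/-- The parameters of a sketch: capacity parameter `k`, number `s` of top compactors of capacity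
`k`, scale `c`, number `t` of compactors to be replaced by the linear compactor, height `H` of the
KLL hierarchy, and the compaction rule of the linear compactor. -/
structure Params where
  k : ℕ
  s : ℕ
  c : ℝ
  t : ℕ
  H : ℕ
  compact : List (ℝ × ℝ) → List (ℝ × ℝ)

namespace Params

variable (P : Params)

/-- The capacity of the KLL compactor at height `h`. -/
def cap (h : ℕ) : ℕ := capacity P.k P.s P.c P.H h

/-- The number of KLL compactors that are replaced by the linear compactor: the top `t` ones, but
never the one at the bottom (this matters only for short streams, where `H ≤ t`). -/
def replaced : ℕ := min P.t (P.H - 1)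

/-- The number of levels below the linear compactor. -/
def levels : ℕ := P.H - P.replaced

/-- The number of lowest levels, whose compactors have capacity `2`; together they are
implemented by a sampler. -/
def samplerLevels : ℕ := sInf {h | 2 < P.cap h}

end Params

/-- The memory of the sketch: the sampler (the number of items seen in the current block, and the
item currently selected from them), the KLL compactors, and the linear compactor. -/
structure State where
  count : ℕ
  sample : ℝ
  buffer : ℕ → List ℝ
  linear : List (ℝ × ℝ)

/-- The empty sketch. -/
def State.init : State := ⟨0, 0, fun _ => [], []⟩

/-- Every other element of a list, starting with the first (`true`) or the second (`false`). -/
def alternate : Bool → List ℝ → List ℝ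
  | _, [] => []
  | true, x :: l => x :: alternate false l
  | false, _ :: l => alternate true l

/-- The linear compactor receives a batch of items: they are added with weight `2 ^ levels`, and
when the total capacity of the replaced compactors is reached, a compaction takes place. -/
def receive (P : Params) (C : List (ℝ × ℝ)) (batch : List ℝ) : List (ℝ × ℝ) :=
  let C' := linAdd C ((2 : ℝ) ^ P.levels) batch
  if P.replaced * P.k ≤ C'.length then P.compact C' else C'

/-- Feed a batch of items into level `levels - r`. For `r = 0` this is the linear compactor. A KLL
compactor that reaches its capacity is compacted: its items are sorted, either the odd or the even
ones are passed on to the next level, with probability `1/2` each, and the others are discarded. -/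
def feed (P : Params) : ℕ → List ℝ → State → PMF State
  | 0, batch, st => PMF.pure { st with linear := receive P st.linear batch }
  | r + 1, batch, st =>
      let h := P.levels - (r + 1)
      let b := st.buffer h ++ batch
      if b.length < P.cap h then
        PMF.pure { st with buffer := Function.update st.buffer h b }
      else
        (PMF.uniformOfFintype Bool).bind fun coin =>
          feed P r (alternate coin ((b.take (P.cap h)).insertionSort (· ≤ ·)))
            { st with buffer := Function.update st.buffer h (b.drop (P.cap h)) }

/-- Process one stream item. The sampler keeps a uniformly random one of the items of the current
block; once the block consists of `2 ^ samplerLevels` items, the selected item is passed on to the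
first level above the sampler. -/
def step (P : Params) (st : State) (x : ℝ) : PMF State :=
  (PMF.uniformOfFintype (Fin (st.count + 1))).bind fun j =>
    let y := if j = 0 then x else st.sample
    if st.count + 1 < 2 ^ P.samplerLevels then
      PMF.pure { st with count := st.count + 1, sample := y }
    else
      feed P (P.levels - P.samplerLevels) [y] { st with count := 0 }

/-- The distribution of the memory after the items of a stream have been processed. -/
def runFrom (P : Params) : State → List ℝ → PMF State
  | st, [] => PMF.pure st
  | st, x :: xs => (step P st x).bind fun st' => runFrom P st' xs

def run (P : Params) (xs : List ℝ) : PMF State := runFrom P State.init xs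

/-- The estimated rank of `q`: the sum of the weights of all stored items `≤ q` in the sampler and
the KLL compactors, plus the value at `q` of the rank function of the linear compactor. -/
def estimate (P : Params) (st : State) (q : ℝ) : ℝ :=
  (if st.sample ≤ q then (st.count : ℝ) else 0)
    + ∑ h ∈ Finset.Ico P.samplerLevels P.levels,
        (2 : ℝ) ^ h * ((st.buffer h).countP fun x => decide (x ≤ q))
    + linRank st.linear q

/-- The number of memory words in use: two for the sampler, one for each KLL compactor and one for
each item in it, and two (point and weight) for each element of the linear compactor. -/
def space (P : Params) (st : State) : ℕ :=
  2 + ∑ h ∈ Finset.Ico P.samplerLevels P.levels, (1 + (st.buffer h).length)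
    + 2 * st.linear.length

/-- The rank of `q` in a stream: the number of items `≤ q`. -/
def rank (xs : List ℝ) (q : ℝ) : ℕ := xs.countP fun x => decide (x ≤ q)

/-- `log log (1 / δ)`, replaced by `1` where it is smaller than `1`. -/
def logLog (δ : ℝ) : ℝ := max 1 (Real.log (Real.log (1 / δ)))

/-- The sketch for streams of length `n` with `k = 2 ⌈K logLog δ / ε⌉` and `s = ⌈A logLog δ⌉`; its
hierarchy has the height with which the KLL sketch of the same parameters terminates. -/
def sketchParams (A K c : ℝ) (t : ℕ) (compact : List (ℝ × ℝ) → List (ℝ × ℝ))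
    (ε δ : ℝ) (n : ℕ) : Params where
  k := 2 * ⌈K * logLog δ / ε⌉₊
  s := ⌈A * logLog δ⌉₊
  c := c
  t := t
  H := kllHeight (2 * ⌈K * logLog δ / ε⌉₊) ⌈A * logLog δ⌉₊ c n
  compact := compact

end LinearSketch

end

/-!
The error of the sketch splits into a random part, produced by the sampler and the KLL compactors
below the top `s` heights, and a deterministic part, produced by everything above them.

*Random part.* Passing on one item of a block of length `B` with weight `B` is an error of mean zero
and size less than `B` (`reaches_block`); compacting at height `h` is an error `± 2 ^ h` with a fair
sign or no error (`two_mul_countP_alternate_sub`). So `cosh (lam x) exp (-lam² v / 2)`, with `x` the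
accumulated error and `v` the accumulated variance proxy, is a supermartingale along the run. The
predicate `Reaches` expresses this together with an invariant that ties `x` and `v` to the memory.
The capacities decrease by factors `c > 1 / 2` while the weights decrease by factors `1 / 2`, so
`v` is dominated by its largest heights and is `O((n / k)² (2 c)^(-s))` (`variance_le`). With
`s ≥ log log (1 / δ) / log (2 c)`, the tail bound `Reaches.measure_le` gives an error above `ε n / 2`
with probability at most `δ`.

*Deterministic part.* A compactor of full size is compacted at most `n / (2 ^ h k)` times, each time
with an error of at most `2 ^ h`, so the top `s` heights contribute at most `s n / k`. As `2 ^ H` is of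
the order `n / k` unless `H = 1`, where no compactor ever fills up, the linear compactor receives a number of batches that depends only on `t`
(`batches_le`), each of which costs `O(n / k)` (`inv_receive`): interpolating in a batch costs the
weight of one item, merging two lists costs at most the jump of a rank function at its first
point (`abs_linRank_linAdd_sub_le`), and a list of `m` points and total weight `W` can be compacted
with a loss of `O(W / m)` (`exists_isCompaction`). The first jump stays small, because an optimal
compaction turns dropped initial points into loss (`JumpLE.compaction`). As `k` is at least
`2 K log log (1 / δ) / ε`, these errors sum up to at most `ε n / 2`.

*Space.* The lists never exceed the capacities, which are `k` at the top `s` heights and decrease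
geometrically below them.
-/

noncomputable section

namespace LinearSketch

/-! ### Rank functions of linear compactors -/

lemma interpFrom_self {a : ℝ} {C : List (ℝ × ℝ)} (h : ∀ y ∈ C.map Prod.fst, a < y) :
    interpFrom a C a = 0 := by
  cases C with
  | nil => rfl
  | cons p C =>
    have : ¬ p.1 ≤ a := not_le.2 (h p.1 (by simp))
    simp [interpFrom, this]

/-- Between two consecutive points the interpolated rank is affine. -/
lemma interpFrom_affine {a : ℝ} {C : List (ℝ × ℝ)} (hC : (a :: C.map Prod.fst).Pairwise (· < ·))
    {u v q : ℝ} (hau : a ≤ u) (huv : u < v) (hgap : ∀ y ∈ C.map Prod.fst, u < y → v ≤ y)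
    (huq : u ≤ q) (hqv : q ≤ v) :
    interpFrom a C q
      = interpFrom a C u + (interpFrom a C v - interpFrom a C u) * ((q - u) / (v - u)) := by
  induction C generalizing a with
  | nil => simp [interpFrom]
  | cons p C ih =>
    obtain ⟨y, w⟩ := p
    have hC' : (y :: C.map Prod.fst).Pairwise (· < ·) := (List.pairwise_cons.1 hC).2
    have hay : a < y := (List.pairwise_cons.1 hC).1 y (by simp)
    have huv' : v - u ≠ 0 := (sub_pos.2 huv).ne'
    by_cases hy : y ≤ u
    · have h1 : y ≤ q := hy.trans huq
      have h2 : y ≤ v := hy.trans huv.le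
      have := ih hC' hy (fun z hz => hgap z (by simp at hz ⊢; tauto))
      simp only [interpFrom, if_pos hy, if_pos h1, if_pos h2]
      rw [this]; ring
    · have hvy : v ≤ y := hgap y (by simp) (not_le.1 hy)
      have hya : y - a ≠ 0 := (sub_pos.2 hay).ne'
      -- the formula on the gap also holds at its right end, where the point itself is counted
      have key : ∀ r, r ≤ v → interpFrom a ((y, w) :: C) r = w * ((r - a) / (y - a)) := by
        intro r hr
        by_cases hyr : y ≤ r
        · have : r = y := le_antisymm (hr.trans hvy) hyr
          subst this
          simp [interpFrom, interpFrom_self (List.pairwise_cons.1 hC').1, div_self hya]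
        · simp [interpFrom, hyr]
      rw [key q hqv, key u huv.le, key v le_rfl]
      field_simp
      ring

lemma interpFrom_nonneg {a : ℝ} {C : List (ℝ × ℝ)} (hw : ∀ p ∈ C, 0 ≤ p.2) {q : ℝ}
    (hC : (a :: C.map Prod.fst).Pairwise (· < ·)) (haq : a ≤ q) : 0 ≤ interpFrom a C q := by
  induction C generalizing a with
  | nil => simp [interpFrom]
  | cons p C ih =>
    obtain ⟨y, w⟩ := p
    have hw0 : 0 ≤ w := hw (y, w) (by simp)
    have hay : a < y := (List.pairwise_cons.1 hC).1 y (by simp)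
    by_cases hy : y ≤ q
    · have := ih (fun p hp => hw p (by simp [hp])) (List.pairwise_cons.1 hC).2 hy
      simp only [interpFrom, if_pos hy]; linarith
    · simp only [interpFrom, if_neg hy]
      exact mul_nonneg hw0 (div_nonneg (by linarith) (by linarith))

lemma interpFrom_mono {a : ℝ} {C : List (ℝ × ℝ)} (hw : ∀ p ∈ C, 0 ≤ p.2) {q r : ℝ}
    (hC : (a :: C.map Prod.fst).Pairwise (· < ·)) (haq : a ≤ q) (hqr : q ≤ r) :
    interpFrom a C q ≤ interpFrom a C r := by
  induction C generalizing a with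
  | nil => simp [interpFrom]
  | cons p C ih =>
    obtain ⟨y, w⟩ := p
    have hw0 : 0 ≤ w := hw (y, w) (by simp)
    have hw' : ∀ p ∈ C, 0 ≤ p.2 := fun p hp => hw p (by simp [hp])
    have hay : a < y := (List.pairwise_cons.1 hC).1 y (by simp)
    have hC' := (List.pairwise_cons.1 hC).2
    have hd : 0 < y - a := sub_pos.2 hay
    by_cases hy : y ≤ q
    · have := ih hw' hC' hy
      simp only [interpFrom, if_pos hy, if_pos (hy.trans hqr)]; linarith
    · by_cases hr : y ≤ r
      · have h0 := interpFrom_nonneg hw' hC' hr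
        simp only [interpFrom, if_neg hy, if_pos hr]
        have : (q - a) / (y - a) ≤ 1 := by rw [div_le_one hd]; linarith
        nlinarith
      · simp only [interpFrom, if_neg hy, if_neg hr]
        gcongr

lemma interpFrom_eq_sum {a : ℝ} {C : List (ℝ × ℝ)} {q : ℝ} (h : ∀ y ∈ C.map Prod.fst, y ≤ q) :
    interpFrom a C q = (C.map Prod.snd).sum := by
  induction C generalizing a with
  | nil => rfl
  | cons p C ih =>
    have hp : p.1 ≤ q := h p.1 (by simp)
    simp only [interpFrom, if_pos hp, List.map_cons, List.sum_cons]
    rw [ih fun y hy => h y (by simp at hy ⊢; tauto)]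

lemma linRank_eq_zero {C : List (ℝ × ℝ)} {q : ℝ} (h : ∀ y ∈ C.map Prod.fst, q < y) :
    linRank C q = 0 := by
  cases C with
  | nil => rfl
  | cons p C => simp [linRank, not_le.2 (h p.1 (by simp))]

lemma linRank_eq_sum {C : List (ℝ × ℝ)} {q : ℝ} (h : ∀ y ∈ C.map Prod.fst, y ≤ q) :
    linRank C q = (C.map Prod.snd).sum := by
  cases C with
  | nil => rfl
  | cons p C =>
    have hp : p.1 ≤ q := h p.1 (by simp)
    simp only [linRank, if_pos hp, List.map_cons, List.sum_cons]
    rw [interpFrom_eq_sum fun y hy => h y (by simp at hy ⊢; tauto)]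

/-- A rank function is affine on an interval without points in its interior, unless the interval
lies before the first point (where the rank jumps from `0` to the first weight). -/
lemma linRank_affine {C : List (ℝ × ℝ)} (hC : (C.map Prod.fst).Pairwise (· < ·)) {u v q : ℝ}
    (hu : ∃ y ∈ C.map Prod.fst, y ≤ u) (huv : u < v)
    (hgap : ∀ y ∈ C.map Prod.fst, u < y → v ≤ y) (huq : u ≤ q) (hqv : q ≤ v) :
    linRank C q = linRank C u + (linRank C v - linRank C u) * ((q - u) / (v - u)) := by
  cases C with
  | nil => simp [linRank]
  | cons p C =>
    obtain ⟨y, w⟩ := p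
    have hy : y ≤ u := by
      obtain ⟨z, hz, hzu⟩ := hu
      rcases List.mem_cons.1 hz with rfl | hz
      · exact hzu
      · exact ((List.pairwise_cons.1 hC).1 z hz).le.trans hzu
    have := interpFrom_affine hC hy huv (fun z hz => hgap z (by simp at hz ⊢; tauto)) huq hqv
    simp only [linRank, if_pos hy, if_pos (hy.trans huq), if_pos (hy.trans huv.le)]
    rw [this]; ring

lemma linRank_mono {C : List (ℝ × ℝ)} (hC : (C.map Prod.fst).Pairwise (· < ·))
    (hw : ∀ p ∈ C, 0 ≤ p.2) : Monotone (linRank C) := by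
  intro q r hqr
  cases C with
  | nil => simp [linRank]
  | cons p C =>
    have hw' : ∀ p ∈ C, 0 ≤ p.2 := fun p hp => hw p (by simp [hp])
    have hp : 0 ≤ p.2 := hw p (by simp)
    by_cases hq : p.1 ≤ q
    · have := interpFrom_mono hw' hC hq hqr
      simp only [linRank, if_pos hq, if_pos (hq.trans hqr)]; linarith
    · by_cases hr : p.1 ≤ r
      · have := interpFrom_nonneg hw' hC hr
        simp only [linRank, if_neg hq, if_pos hr]; linarith
      · simp [linRank, hq, hr]

lemma linRank_le_sum {C : List (ℝ × ℝ)} (hC : (C.map Prod.fst).Pairwise (· < ·))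
    (hw : ∀ p ∈ C, 0 ≤ p.2) (q : ℝ) : linRank C q ≤ (C.map Prod.snd).sum := by
  obtain ⟨M, hM⟩ := (C.map Prod.fst).toFinset.bddAbove
  rw [← linRank_eq_sum (C := C) (q := max q M)
    fun y hy => le_max_of_le_right (hM (by simpa using hy))]
  exact linRank_mono hC hw (le_max_left _ _)

lemma linRank_nonneg {C : List (ℝ × ℝ)} (hC : (C.map Prod.fst).Pairwise (· < ·))
    (hw : ∀ p ∈ C, 0 ≤ p.2) (q : ℝ) : 0 ≤ linRank C q := by
  obtain ⟨M, hM⟩ := (C.map Prod.fst).toFinset.bddBelow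
  rw [← linRank_eq_zero (C := C) (q := min q (M - 1))
    fun y hy => (min_le_right _ _).trans_lt ((sub_one_lt M).trans_le (hM (by simpa using hy)))]
  exact linRank_mono hC hw (min_le_left _ _)

/-! ### Finite differences -/

@[simp] lemma map_fst_finiteDiff (g : ℝ → ℝ) (v : ℝ) (zs : List ℝ) :
    (finiteDiff g v zs).map Prod.fst = zs := by
  induction zs generalizing v with
  | nil => rfl
  | cons z zs ih => simp [finiteDiff, ih]

lemma length_finiteDiff (g : ℝ → ℝ) (v : ℝ) (zs : List ℝ) :
    (finiteDiff g v zs).length = zs.length := by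
  rw [← List.length_map (f := Prod.fst), map_fst_finiteDiff]

lemma interpFrom_finiteDiff {g : ℝ → ℝ} {a v : ℝ} {zs : List ℝ}
    (hzs : (a :: zs).Pairwise (· < ·)) {z : ℝ} (hz : z ∈ zs) :
    interpFrom a (finiteDiff g v zs) z = g z - v := by
  induction zs generalizing a v with
  | nil => simp at hz
  | cons y zs ih =>
    have hzs' := (List.pairwise_cons.1 hzs).2
    rcases List.mem_cons.1 hz with rfl | hz
    · simp [finiteDiff, interpFrom, interpFrom_self (a := z) (C := finiteDiff g (g z) zs)
        (by simpa using (List.pairwise_cons.1 hzs').1)]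
    · have : y ≤ z := ((List.pairwise_cons.1 hzs').1 z hz).le
      simp [finiteDiff, interpFrom, this, ih hzs' hz]

/-- The linear compactor of the finite differences of `g` has the ranks prescribed by `g`. -/
lemma linRank_finiteDiff {g : ℝ → ℝ} {zs : List ℝ} (hzs : zs.Pairwise (· < ·)) {z : ℝ}
    (hz : z ∈ zs) : linRank (finiteDiff g 0 zs) z = g z := by
  cases zs with
  | nil => simp at hz
  | cons y zs =>
    rcases List.mem_cons.1 hz with rfl | hz
    · simp [finiteDiff, linRank, interpFrom_self (a := z) (C := finiteDiff g (g z) zs)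
        (by simpa using (List.pairwise_cons.1 hzs).1)]
    · have : y ≤ z := ((List.pairwise_cons.1 hzs).1 z hz).le
      simp [finiteDiff, linRank, this, interpFrom_finiteDiff hzs hz]

lemma eq_finiteDiff_of_interpFrom {g : ℝ → ℝ} {a v : ℝ} {C : List (ℝ × ℝ)}
    (hC : (a :: C.map Prod.fst).Pairwise (· < ·)) (h : ∀ p ∈ C, interpFrom a C p.1 = g p.1 - v) :
    C = finiteDiff g v (C.map Prod.fst) := by
  induction C generalizing a v with
  | nil => rfl
  | cons p C ih =>
    obtain ⟨y, w⟩ := p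
    have hC' : (y :: C.map Prod.fst).Pairwise (· < ·) := (List.pairwise_cons.1 hC).2
    have hw : w = g y - v := by
      simpa [interpFrom, interpFrom_self (List.pairwise_cons.1 hC').1] using h (y, w) (by simp)
    have := ih (v := g y) hC' fun p hp => by
      have h1 : y ≤ p.1 := ((List.pairwise_cons.1 hC').1 p.1 (List.mem_map_of_mem hp)).le
      have h2 := h p (by simp [hp])
      simp only [interpFrom, if_pos h1] at h2
      linarith
    simp only [List.map_cons, finiteDiff, ← this, hw]

/-- The weights of a linear compactor are determined by its points and the ranks of its points. -/
lemma eq_finiteDiff_of_linRank {g : ℝ → ℝ} {C : List (ℝ × ℝ)}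
    (hC : (C.map Prod.fst).Pairwise (· < ·)) (h : ∀ p ∈ C, linRank C p.1 = g p.1) :
    C = finiteDiff g 0 (C.map Prod.fst) := by
  cases C with
  | nil => rfl
  | cons p C =>
    obtain ⟨y, w⟩ := p
    have hw : w = g y := by
      simpa [linRank, interpFrom_self (List.pairwise_cons.1 hC).1] using h (y, w) (by simp)
    have := eq_finiteDiff_of_interpFrom (g := g) (v := g y) hC fun p hp => by
      have h1 : y ≤ p.1 := ((List.pairwise_cons.1 hC).1 p.1 (List.mem_map_of_mem hp)).le
      have h2 := h p (by simp [hp])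
      simp only [linRank, if_pos h1] at h2
      linarith
    simp only [List.map_cons, finiteDiff, ← this, hw, sub_zero]

lemma finiteDiff_nonneg {g : ℝ → ℝ} (hg : Monotone g) {v : ℝ} {zs : List ℝ}
    (hzs : zs.Pairwise (· < ·)) (hv : ∀ z ∈ zs, v ≤ g z) :
    ∀ p ∈ finiteDiff g v zs, 0 ≤ p.2 := by
  induction zs generalizing v with
  | nil => simp [finiteDiff]
  | cons z zs ih =>
    intro p hp
    simp only [finiteDiff, List.mem_cons] at hp
    rcases hp with rfl | hp
    · simpa using hv z (by simp)
    · exact ih (List.pairwise_cons.1 hzs).2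
        (fun y hy => hg ((List.pairwise_cons.1 hzs).1 y hy).le) p hp

/-- The sum of finite differences telescopes. -/
lemma sum_finiteDiff {g : ℝ → ℝ} {v : ℝ} {zs : List ℝ} (hzs : zs.Pairwise (· < ·)) {z : ℝ}
    (hz : z ∈ zs) (hmax : ∀ y ∈ zs, y ≤ z) :
    ((finiteDiff g v zs).map Prod.snd).sum = g z - v := by
  induction zs generalizing v with
  | nil => simp at hz
  | cons y zs ih =>
    rcases List.mem_cons.1 hz with rfl | hz
    · have : zs = [] := by
        refine List.eq_nil_iff_forall_not_mem.2 fun y hy => ?_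
        exact absurd ((List.pairwise_cons.1 hzs).1 y hy) (not_lt.2 (hmax y (by simp [hy])))
      subst this
      simp [finiteDiff]
    · simp only [finiteDiff, List.map_cons, List.sum_cons,
        ih (List.pairwise_cons.1 hzs).2 hz fun y hy => hmax y (by simp [hy])]
      ring

/-! ### Neighbours in a list of points -/

lemma exists_pred (l : List ℝ) (q : ℝ) :
    (∀ y ∈ l, q < y) ∨ ∃ a ∈ l, a ≤ q ∧ ∀ y ∈ l, y ≤ q → y ≤ a := by
  by_cases h : ∃ y ∈ l, y ≤ q
  · obtain ⟨y, hy, hyq⟩ := h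
    obtain ⟨a, ha, hmax⟩ := (l.toFinset.filter (· ≤ q)).exists_max_image id
      ⟨y, by simp [hy, hyq]⟩
    simp only [Finset.mem_filter, List.mem_toFinset, id] at ha hmax
    exact Or.inr ⟨a, ha.1, ha.2, fun y hy hyq => hmax y ⟨hy, hyq⟩⟩
  · push Not at h
    exact Or.inl h

lemma exists_pred_lt (l : List ℝ) (q : ℝ) :
    (∀ y ∈ l, q ≤ y) ∨ ∃ a ∈ l, a < q ∧ ∀ y ∈ l, y < q → y ≤ a := by
  by_cases h : ∃ y ∈ l, y < q
  · obtain ⟨y, hy, hyq⟩ := h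
    obtain ⟨a, ha, hmax⟩ := (l.toFinset.filter (· < q)).exists_max_image id
      ⟨y, by simp [hy, hyq]⟩
    simp only [Finset.mem_filter, List.mem_toFinset, id] at ha hmax
    exact Or.inr ⟨a, ha.1, ha.2, fun y hy hyq => hmax y ⟨hy, hyq⟩⟩
  · push Not at h
    exact Or.inl h

lemma exists_succ (l : List ℝ) (q : ℝ) :
    (∀ y ∈ l, y ≤ q) ∨ ∃ b ∈ l, q < b ∧ ∀ y ∈ l, q < y → b ≤ y := by
  by_cases h : ∃ y ∈ l, q < y
  · obtain ⟨y, hy, hyq⟩ := h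
    obtain ⟨b, hb, hmin⟩ := (l.toFinset.filter (q < ·)).exists_min_image id
      ⟨y, by simp [hy, hyq]⟩
    simp only [Finset.mem_filter, List.mem_toFinset, id] at hb hmin
    exact Or.inr ⟨b, hb.1, hb.2, fun y hy hyq => hmin y ⟨hy, hyq⟩⟩
  · push Not at h
    exact Or.inl h

/-! ### Adding a batch -/

/-- A linear compactor with increasing points and nonnegative weights. -/
structure IsProper (C : List (ℝ × ℝ)) : Prop where
  sorted : (C.map Prod.fst).Pairwise (· < ·)
  nonneg : ∀ p ∈ C, 0 ≤ p.2

lemma IsProper.mono {C : List (ℝ × ℝ)} (hC : IsProper C) : Monotone (linRank C) :=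
  linRank_mono hC.sorted hC.nonneg

/-- The rank function of `C` jumps by at most `D` at its first point. -/
def JumpLE (D : ℝ) (C : List (ℝ × ℝ)) : Prop :=
  ∀ b, (∀ y ∈ C.map Prod.fst, b ≤ y) → linRank C b ≤ D

/-- A batch of items, as a linear compactor with constant weight. -/
def batchList (w : ℝ) (ys : List ℝ) : List (ℝ × ℝ) :=
  (ys.insertionSort (· ≤ ·)).map fun y => (y, w)

lemma map_fst_batchList (w : ℝ) (ys : List ℝ) :
    (batchList w ys).map Prod.fst = ys.insertionSort (· ≤ ·) := by
  simp [batchList, Function.comp_def]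

lemma pairwise_insertionSort_lt {l : List ℝ} (hl : l.Nodup) :
    (l.insertionSort (· ≤ ·)).Pairwise (· < ·) := by
  have h1 := List.pairwise_insertionSort (· ≤ ·) l
  have h2 : (l.insertionSort (· ≤ ·)).Nodup := (List.perm_insertionSort _ l).nodup_iff.2 hl
  exact h1.imp₂ (fun a b hab hne => lt_of_le_of_ne hab hne) h2

lemma isProper_batchList {w : ℝ} (hw : 0 ≤ w) {ys : List ℝ} (hys : ys.Nodup) :
    IsProper (batchList w ys) where
  sorted := by rw [map_fst_batchList]; exact pairwise_insertionSort_lt hys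
  nonneg := by
    intro p hp
    obtain ⟨y, -, rfl⟩ := List.mem_map.1 hp
    exact hw

lemma sum_batchList (w : ℝ) (ys : List ℝ) :
    ((batchList w ys).map Prod.snd).sum = w * ys.length := by
  simp [batchList, Function.comp_def, mul_comm]

lemma interpFrom_const_weight {w : ℝ} (hw : 0 ≤ w) {a : ℝ} {l : List ℝ}
    (hl : (a :: l).Pairwise (· < ·)) {q : ℝ} (haq : a ≤ q) :
    0 ≤ interpFrom a (l.map fun y => (y, w)) q - w * (l.countP fun x => decide (x ≤ q)) ∧
    interpFrom a (l.map fun y => (y, w)) q - w * (l.countP fun x => decide (x ≤ q)) ≤ w := by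
  induction l generalizing a with
  | nil => simpa [interpFrom] using hw
  | cons y l ih =>
    have hl' := (List.pairwise_cons.1 hl).2
    have hay : a < y := (List.pairwise_cons.1 hl).1 y (by simp)
    by_cases hy : y ≤ q
    · have := ih hl' hy
      simp only [List.map_cons, interpFrom, hy, if_true, List.countP_cons, decide_true]
      push_cast
      constructor <;> nlinarith
    · have h0 : (y :: l).countP (fun x => decide (x ≤ q)) = 0 := by
        refine List.countP_eq_zero.2 fun z hz => ?_
        rcases List.mem_cons.1 hz with rfl | hz
        · simpa using hy
        · have := (List.pairwise_cons.1 hl').1 z hz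
          simp only [decide_eq_true_eq, not_le] at hy ⊢
          exact hy.trans this
      simp only [List.map_cons, interpFrom, if_neg hy, h0]
      have hd : 0 < y - a := sub_pos.2 hay
      have h1 : (q - a) / (y - a) ≤ 1 := by rw [div_le_one hd]; linarith
      have h2 : 0 ≤ (q - a) / (y - a) := div_nonneg (by linarith) hd.le
      constructor <;> norm_num <;> nlinarith

/-- Interpolation changes the rank in a batch by at most the weight of one item. -/
lemma abs_linRank_batchList_sub_le {w : ℝ} (hw : 0 ≤ w) {ys : List ℝ} (hys : ys.Nodup) (q : ℝ) :
    |linRank (batchList w ys) q - w * (ys.countP fun x => decide (x ≤ q))| ≤ w := by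
  have hs := pairwise_insertionSort_lt hys
  rw [← (List.perm_insertionSort (· ≤ ·) ys).countP_eq, batchList]
  generalize ys.insertionSort (· ≤ ·) = l at hs
  cases l with
  | nil => simpa [linRank] using hw
  | cons y l =>
    by_cases hy : y ≤ q
    · have := interpFrom_const_weight hw hs hy
      simp only [List.map_cons, linRank, hy, if_true, List.countP_cons, decide_true]
      push_cast
      rw [abs_le]
      constructor <;> nlinarith
    · have h0 : (y :: l).countP (fun x => decide (x ≤ q)) = 0 := by
        refine List.countP_eq_zero.2 fun z hz => ?_
        rcases List.mem_cons.1 hz with rfl | hz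
        · simpa using hy
        · have := (List.pairwise_cons.1 hs).1 z hz
          simp only [decide_eq_true_eq, not_le] at hy ⊢
          exact hy.trans this
      simp [linRank, hy, h0, hw]

lemma jumpLE_batchList {w : ℝ} (hw : 0 ≤ w) {ys : List ℝ} (hys : ys.Nodup) :
    JumpLE w (batchList w ys) := by
  intro b hb
  rw [map_fst_batchList] at hb
  have hs := pairwise_insertionSort_lt hys
  unfold batchList
  generalize ys.insertionSort (· ≤ ·) = l at hb hs
  cases l with
  | nil => simpa [linRank] using hw
  | cons y l =>
    rcases (hb y (by simp)).lt_or_eq with h | rfl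
    · simpa [linRank, not_le.2 h] using hw
    · simp [linRank, interpFrom_self (a := b) (C := l.map fun y => (y, w))
        (by simpa [Function.comp_def] using (List.pairwise_cons.1 hs).1)]

lemma linAdd_eq (C : List (ℝ × ℝ)) (w : ℝ) (ys : List ℝ) :
    linAdd C w ys = finiteDiff (fun z => linRank C z + linRank (batchList w ys) z) 0
      ((C.map Prod.fst ++ ys).insertionSort (· ≤ ·)) := rfl

lemma map_fst_linAdd (C : List (ℝ × ℝ)) (w : ℝ) (ys : List ℝ) :
    (linAdd C w ys).map Prod.fst = (C.map Prod.fst ++ ys).insertionSort (· ≤ ·) := by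
  rw [linAdd_eq, map_fst_finiteDiff]

lemma length_linAdd (C : List (ℝ × ℝ)) (w : ℝ) (ys : List ℝ) :
    (linAdd C w ys).length = C.length + ys.length := by
  rw [linAdd_eq, length_finiteDiff, List.length_insertionSort]; simp

lemma isProper_linAdd {C : List (ℝ × ℝ)} (hC : IsProper C) {w : ℝ} (hw : 0 ≤ w) {ys : List ℝ}
    (hnd : (C.map Prod.fst ++ ys).Nodup) : IsProper (linAdd C w ys) := by
  have hY := isProper_batchList hw (List.nodup_append.1 hnd).2.1
  refine ⟨by rw [map_fst_linAdd]; exact pairwise_insertionSort_lt hnd, ?_⟩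
  rw [linAdd_eq]
  exact finiteDiff_nonneg (hC.mono.add hY.mono) (pairwise_insertionSort_lt hnd)
    fun z _ => add_nonneg (linRank_nonneg hC.sorted hC.nonneg z)
      (linRank_nonneg hY.sorted hY.nonneg z)

lemma linRank_linAdd_of_mem {C : List (ℝ × ℝ)} {w : ℝ} {ys : List ℝ}
    (hnd : (C.map Prod.fst ++ ys).Nodup) {z : ℝ} (hz : z ∈ C.map Prod.fst ++ ys) :
    linRank (linAdd C w ys) z = linRank C z + linRank (batchList w ys) z := by
  rw [linAdd_eq]
  exact linRank_finiteDiff (g := fun z => linRank C z + linRank (batchList w ys) z)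
    (pairwise_insertionSort_lt hnd) (by simpa using hz)

lemma sum_linAdd {C : List (ℝ × ℝ)} {w : ℝ} {ys : List ℝ}
    (hnd : (C.map Prod.fst ++ ys).Nodup) :
    ((linAdd C w ys).map Prod.snd).sum = (C.map Prod.snd).sum + w * ys.length := by
  by_cases hne : C.map Prod.fst ++ ys = []
  · obtain ⟨h1, rfl⟩ := List.append_eq_nil_iff.1 hne
    have : C = [] := List.map_eq_nil_iff.1 h1
    subst this
    simp [linAdd, finiteDiff]
  · obtain ⟨z, hz, hmax⟩ := (C.map Prod.fst ++ ys).toFinset.exists_max_image id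
      (List.toFinset_nonempty_iff _ |>.2 hne)
    simp only [List.mem_toFinset, id] at hz hmax
    rw [linAdd_eq, sum_finiteDiff (pairwise_insertionSort_lt hnd) (z := z) (by simpa using hz)
      (by simpa using hmax), sub_zero, linRank_eq_sum fun y hy => hmax y (by simp [hy]),
      linRank_eq_sum fun y hy => hmax y (by rw [map_fst_batchList] at hy; simp_all),
      sum_batchList]

/-- Adding a batch keeps the first jump small: the first point comes from only one of the two
lists, and before its first point the other rank function vanishes. -/
lemma JumpLE.linAdd {D : ℝ} {C : List (ℝ × ℝ)} (hC : JumpLE D C) {w : ℝ} (hw : 0 ≤ w) (hwD : w ≤ D)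
    {ys : List ℝ} (hnd : (C.map Prod.fst ++ ys).Nodup) : JumpLE D (linAdd C w ys) := by
  intro b hb
  rw [map_fst_linAdd] at hb
  simp only [List.mem_insertionSort, List.mem_append] at hb
  have hbY : ∀ y ∈ (batchList w ys).map Prod.fst, b ≤ y := by
    intro y hy
    rw [map_fst_batchList, List.mem_insertionSort] at hy
    exact hb y (Or.inr hy)
  have hY := jumpLE_batchList hw (List.nodup_append.1 hnd).2.1
  by_cases hbm : b ∈ C.map Prod.fst ++ ys
  · rw [linRank_linAdd_of_mem hnd hbm]
    by_cases hbC : b ∈ C.map Prod.fst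
    · have h0 : linRank (batchList w ys) b = 0 := by
        refine linRank_eq_zero fun y hy => (hbY y hy).lt_of_ne ?_
        rintro rfl
        rw [map_fst_batchList, List.mem_insertionSort] at hy
        exact (List.nodup_append.1 hnd).2.2 _ hbC _ hy rfl
      rw [h0, add_zero]
      exact hC b fun y hy => hb y (Or.inl hy)
    · have h0 : linRank C b = 0 := by
        refine linRank_eq_zero fun y hy => (hb y (Or.inl hy)).lt_of_ne ?_
        rintro rfl
        exact hbC hy
      rw [h0, zero_add]
      exact (hY b hbY).trans hwD
  · rw [linRank_eq_zero]
    · linarith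
    · intro y hy
      rw [map_fst_linAdd, List.mem_insertionSort] at hy
      refine (hb y (List.mem_append.1 hy)).lt_of_ne ?_
      rintro rfl
      exact hbm hy

/-- Replacing a rank function on an interval without interior points by its linear interpolation
costs at most the jump at the first point. -/
lemma abs_interpolation_sub_le {D : ℝ} {C : List (ℝ × ℝ)} (hC : IsProper C) (hJ : JumpLE D C)
    {a b q : ℝ} (hab : a < b) (hgap : ∀ y ∈ C.map Prod.fst, a < y → b ≤ y)
    (haq : a ≤ q) (hqb : q < b) :
    |linRank C a + (linRank C b - linRank C a) * ((q - a) / (b - a)) - linRank C q|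
      ≤ if ∃ y ∈ C.map Prod.fst, y ≤ a then 0 else D := by
  split_ifs with h
  · rw [linRank_affine hC.sorted h hab hgap haq hqb.le]; simp
  · push Not at h
    have hb : ∀ y ∈ C.map Prod.fst, b ≤ y := fun y hy => hgap y hy (h y hy)
    rw [linRank_eq_zero h, linRank_eq_zero fun y hy => hqb.trans_le (hb y hy)]
    have hd : 0 < b - a := sub_pos.2 hab
    have h0 := linRank_nonneg hC.sorted hC.nonneg b
    have h1 : (q - a) / (b - a) ≤ 1 := by rw [div_le_one hd]; linarith
    have h2 : 0 ≤ (q - a) / (b - a) := div_nonneg (by linarith) hd.le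
    have h3 := hJ b hb
    rw [abs_of_nonneg (by simp; positivity)]
    simp only [zero_add, sub_zero]
    nlinarith

/-- The rank function after adding a batch differs from the sum of the two rank functions only by
turning one first jump into a linear piece. -/
lemma abs_linRank_linAdd_sub_le {D : ℝ} {C : List (ℝ × ℝ)} (hC : IsProper C) (hJ : JumpLE D C)
    {w : ℝ} (hw : 0 ≤ w) (hwD : w ≤ D) {ys : List ℝ} (hnd : (C.map Prod.fst ++ ys).Nodup) (q : ℝ) :
    |linRank (linAdd C w ys) q - (linRank C q + linRank (batchList w ys) q)| ≤ D := by
  have hY := isProper_batchList hw (List.nodup_append.1 hnd).2.1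
  have hYJ : JumpLE D (batchList w ys) := fun b hb =>
    (jumpLE_batchList hw (List.nodup_append.1 hnd).2.1 b hb).trans hwD
  have hmem : ∀ y, y ∈ (batchList w ys).map Prod.fst ↔ y ∈ ys := fun y => by
    rw [map_fst_batchList, List.mem_insertionSort]
  have hmemA : ∀ y, y ∈ (linAdd C w ys).map Prod.fst ↔ y ∈ C.map Prod.fst ++ ys := fun y => by
    rw [map_fst_linAdd, List.mem_insertionSort]
  have hA := isProper_linAdd hC hw hnd
  rcases exists_pred (C.map Prod.fst ++ ys) q with h | ⟨a, ha, haq, hamax⟩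
  · rw [linRank_eq_zero fun y hy => h y ((hmemA y).1 hy),
      linRank_eq_zero fun y hy => h y (List.mem_append_left _ hy),
      linRank_eq_zero fun y hy => h y (List.mem_append_right _ ((hmem y).1 hy))]
    simpa using hw.trans hwD
  rcases exists_succ (C.map Prod.fst ++ ys) q with h | ⟨b, hb, hqb, hbmin⟩
  · rw [linRank_eq_sum fun y hy => h y ((hmemA y).1 hy),
      linRank_eq_sum fun y hy => h y (List.mem_append_left _ hy),
      linRank_eq_sum fun y hy => h y (List.mem_append_right _ ((hmem y).1 hy)),
      sum_linAdd hnd, sum_batchList]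
    simpa using hw.trans hwD
  have hgap : ∀ y ∈ C.map Prod.fst ++ ys, a < y → b ≤ y := by
    intro y hy hay
    by_contra hyb
    rcases le_or_gt y q with h | h
    · exact absurd (hamax y hy h) (not_le.2 hay)
    · exact hyb (hbmin y hy h)
  have hab := haq.trans_lt hqb
  have e1 := abs_interpolation_sub_le hC hJ hab
    (fun y hy => hgap y (List.mem_append_left _ hy)) haq hqb
  have e2 := abs_interpolation_sub_le hY hYJ hab
    (fun y hy => hgap y (List.mem_append_right _ ((hmem y).1 hy))) haq hqb
  have e3 := linRank_affine hA.sorted ⟨a, (hmemA a).2 ha, le_rfl⟩ hab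
    (fun y hy => hgap y ((hmemA y).1 hy)) haq hqb.le
  rw [linRank_linAdd_of_mem hnd ha, linRank_linAdd_of_mem hnd hb] at e3
  -- `a` is a point of one of the lists, so at most one of the two errors is nonzero
  have e4 : (if ∃ y ∈ C.map Prod.fst, y ≤ a then 0 else D)
      + (if ∃ y ∈ (batchList w ys).map Prod.fst, y ≤ a then 0 else D) ≤ D := by
    have hD := hw.trans hwD
    rcases List.mem_append.1 ha with h | h
    · rw [if_pos ⟨a, h, le_rfl⟩]; split_ifs <;> linarith
    · rw [if_pos (c := ∃ y ∈ (batchList w ys).map Prod.fst, y ≤ a) ⟨a, (hmem a).2 h, le_rfl⟩]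
      split_ifs <;> linarith
  refine le_trans ?_ ((add_le_add e1 e2).trans e4)
  refine le_trans (le_of_eq ?_) (abs_add_le _ _)
  rw [e3]
  congr 1
  ring

/-! ### Compaction of linear compactors -/

/-- A compaction is determined by its points. -/
lemma IsCompaction.eq_finiteDiff {C C' : List (ℝ × ℝ)} (h : IsCompaction C C')
    (hC : (C.map Prod.fst).Pairwise (· < ·)) :
    C' = finiteDiff (linRank C) 0 (C'.map Prod.fst) :=
  eq_finiteDiff_of_linRank (hC.sublist h.sublist) h.rank_eq

lemma IsCompaction.isProper {C C' : List (ℝ × ℝ)} (h : IsCompaction C C') (hC : IsProper C) :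
    IsProper C' := by
  have hs := hC.sorted.sublist h.sublist
  refine ⟨hs, ?_⟩
  rw [h.eq_finiteDiff hC.sorted]
  exact finiteDiff_nonneg hC.mono hs fun z _ => linRank_nonneg hC.sorted hC.nonneg z

lemma finite_setOf_isCompaction {C : List (ℝ × ℝ)} (hC : (C.map Prod.fst).Pairwise (· < ·)) :
    {C' | IsCompaction C C'}.Finite := by
  refine Set.Finite.subset
    ((C.map Prod.fst).sublists.toFinset.finite_toSet.image (finiteDiff (linRank C) 0)) ?_
  intro C' h
  exact ⟨C'.map Prod.fst, by simpa using h.sublist, (h.eq_finiteDiff hC).symm⟩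

lemma exists_isOptimalCompaction {C : List (ℝ × ℝ)} (hC : (C.map Prod.fst).Pairwise (· < ·))
    (h : ∃ C', IsCompaction C C') : ∃ C', IsOptimalCompaction C C' := by
  obtain ⟨C', h1, h2⟩ := Set.exists_min_image _ (supLoss C) (finite_setOf_isCompaction hC) h
  exact ⟨C', h1, h2⟩

/-- A linear compactor of `m` points and total weight at most `τ m / 8` can be compacted with a
loss of at most `τ`. For every multiple `j τ` of `τ` up to the total weight, the first point of rank
at least `j τ` and its predecessor are kept, and so is the last point; these are at most
`m / 4 + 1` points, and others are added arbitrarily. Between two consecutive kept points either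
there was no point, or the rank grows by at most `τ`. -/
lemma exists_isCompaction {C : List (ℝ × ℝ)} (hC : IsProper C) {τ : ℝ} (hτ : 0 < τ)
    (hW : 8 * (C.map Prod.snd).sum ≤ τ * C.length) (hm : 4 ≤ C.length) :
    ∃ C', IsCompaction C C' ∧ ∀ q, |linRank C q - linRank C' q| ≤ τ := by
  classical
  set pts := C.map Prod.fst with hpts
  set f := linRank C with hf
  set W := (C.map Prod.snd).sum with hWdef
  have hmono : Monotone f := hC.mono
  have hf0 : ∀ q, 0 ≤ f q := linRank_nonneg hC.sorted hC.nonneg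
  have hfW : ∀ q, f q ≤ W := linRank_le_sum hC.sorted hC.nonneg
  have hlen : pts.length = C.length := by simp [hpts]
  have hnd : pts.Nodup := hC.sorted.imp fun h => h.ne
  have hne : pts.toFinset.Nonempty := by
    rw [List.toFinset_nonempty_iff, ← List.length_pos_iff]; omega
  obtain ⟨z, hz, hzmax⟩ := pts.toFinset.exists_max_image id hne
  simp only [List.mem_toFinset, id] at hz hzmax
  have hfz : f z = W := linRank_eq_sum hzmax
  set J := ⌊W / τ⌋₊ with hJ
  -- the first points of rank at least `j τ`
  have hfirst : ∀ j : ℕ, ∃ y ∈ pts, (j : ℝ) * τ ≤ W →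
      (j * τ ≤ f y ∧ ∀ p ∈ pts, j * τ ≤ f p → y ≤ p) := by
    intro j
    by_cases hj : (j : ℝ) * τ ≤ W
    · obtain ⟨y, hy, hmin⟩ := (pts.toFinset.filter fun p => j * τ ≤ f p).exists_min_image id
        ⟨z, by simp [hz, hfz, hj]⟩
      simp only [Finset.mem_filter, List.mem_toFinset, id] at hy hmin
      exact ⟨y, hy.1, fun _ => ⟨hy.2, fun p hp h => hmin p ⟨hp, h⟩⟩⟩
    · exact ⟨z, hz, fun h => absurd h hj⟩
  choose y hy hyprop using hfirst
  have hpred : ∀ b : ℝ, ∃ a ∈ pts, (∃ p ∈ pts, p < b) → a < b ∧ ∀ p ∈ pts, p < b → p ≤ a := by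
    intro b
    rcases exists_pred_lt pts b with h | ⟨a, ha, h1, h2⟩
    · exact ⟨z, hz, fun ⟨p, hp, hpb⟩ => absurd (h p hp) (not_le.2 hpb)⟩
    · exact ⟨a, ha, fun _ => ⟨h1, h2⟩⟩
  choose pred hpredm hpredp using hpred
  set S₀ : Finset ℝ := insert z ((Finset.Icc 1 J).image y ∪ (Finset.Icc 1 J).image fun j => pred (y j))
    with hS₀
  have hS₀sub : S₀ ⊆ pts.toFinset := by
    intro x hx
    simp only [hS₀, Finset.mem_insert, Finset.mem_union, Finset.mem_image] at hx
    rw [List.mem_toFinset]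
    rcases hx with rfl | ⟨j, -, rfl⟩ | ⟨j, -, rfl⟩
    · exact hz
    · exact hy j
    · exact hpredm _
  have hJle : 8 * J ≤ C.length := by
    have h1 : (J : ℝ) ≤ W / τ := Nat.floor_le (div_nonneg (hfz ▸ hf0 z) hτ.le)
    rw [le_div_iff₀ hτ] at h1
    have : (8 * J : ℝ) * τ ≤ C.length * τ := by nlinarith
    exact_mod_cast le_of_mul_le_mul_right this hτ
  have hS₀card : S₀.card ≤ C.length / 2 := by
    have h1 := Finset.card_insert_le z
      ((Finset.Icc 1 J).image y ∪ (Finset.Icc 1 J).image fun j => pred (y j))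
    have h2 := Finset.card_union_le ((Finset.Icc 1 J).image y)
      ((Finset.Icc 1 J).image fun j => pred (y j))
    have h3 := Finset.card_image_le (s := Finset.Icc 1 J) (f := y)
    have h4 := Finset.card_image_le (s := Finset.Icc 1 J) (f := fun j => pred (y j))
    rw [Nat.card_Icc] at h3 h4
    rw [hS₀]
    omega
  obtain ⟨S, hS₀S, hSpts, hScard⟩ := Finset.exists_subsuperset_card_eq hS₀sub hS₀card
    (by rw [List.toFinset_card_of_nodup hnd, hlen]; omega)
  set zs := pts.filter (· ∈ S) with hzs
  have hmem : ∀ x, x ∈ zs ↔ x ∈ S := by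
    intro x
    simp only [hzs, List.mem_filter, decide_eq_true_eq, and_iff_right_iff_imp]
    exact fun h => List.mem_toFinset.1 (hSpts h)
  have hzsub : zs.Sublist pts := List.filter_sublist
  have hzsort : zs.Pairwise (· < ·) := hC.sorted.sublist hzsub
  have hzS : z ∈ S := hS₀S (by simp [hS₀])
  have hC'mem : ∀ x, x ∈ (finiteDiff f 0 zs).map Prod.fst ↔ x ∈ S := by simpa using hmem
  have hrank : ∀ x ∈ S, linRank (finiteDiff f 0 zs) x = f x := fun x hx =>
    linRank_finiteDiff hzsort ((hmem x).2 hx)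
  have hsum : ((finiteDiff f 0 zs).map Prod.snd).sum = W := by
    rw [sum_finiteDiff hzsort ((hmem z).2 hzS) fun x hx => hzmax x (hzsub.subset hx), hfz, sub_zero]
  -- if the rank grows by more than `τ` up to a kept point `b`, its predecessor is kept
  have hgap : ∀ a b, b ∈ S → f a + τ < f b → (∀ x ∈ S, a < x → b ≤ x) → (∃ p ∈ pts, p < b) →
      pred b ∈ S := by
    intro a b hb hab hmin hp
    set j := ⌊f a / τ⌋₊ + 1 with hj
    have h1 : f a < j * τ := by
      rw [← div_lt_iff₀ hτ, hj]; push_cast; exact Nat.lt_floor_add_one _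
    have h2 : (j : ℝ) * τ ≤ f a + τ := by
      have := Nat.floor_le (div_nonneg (hf0 a) hτ.le)
      rw [le_div_iff₀ hτ] at this
      rw [hj]; push_cast; linarith
    have h3 : (j : ℝ) * τ ≤ W := h2.trans (hab.le.trans (hfW b))
    have hjJ : j ∈ Finset.Icc 1 J := by
      rw [Finset.mem_Icc]
      exact ⟨by omega, Nat.le_floor (by rwa [le_div_iff₀ hτ])⟩
    obtain ⟨h4, h5⟩ := hyprop j h3
    have h6 : y j ≤ b := h5 b (List.mem_toFinset.1 (hSpts hb)) (h2.trans hab.le)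
    have h7 : a < y j := by
      by_contra h
      exact absurd (hmono (not_lt.1 h)) (not_le.2 (h1.trans_le h4))
    have h8 : y j ∈ S := hS₀S (by
      simp only [hS₀, Finset.mem_insert, Finset.mem_union, Finset.mem_image]
      exact Or.inr (Or.inl ⟨j, hjJ, rfl⟩))
    have h9 : b = y j := le_antisymm (hmin _ h8 h7) h6
    rw [h9]
    refine hS₀S ?_
    simp only [hS₀, Finset.mem_insert, Finset.mem_union, Finset.mem_image]
    exact Or.inr (Or.inr ⟨j, hjJ, rfl⟩)
  refine ⟨finiteDiff f 0 zs, ⟨by simpa using hzsub, ?_, hsum, ?_⟩, ?_⟩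
  · rw [length_finiteDiff, ← hScard, ← List.toFinset_card_of_nodup (hnd.sublist hzsub)]
    congr 1
    ext x
    rw [List.mem_toFinset, hmem]
  · intro p hp
    exact hrank p.1 ((hC'mem p.1).1 (List.mem_map_of_mem hp))
  · intro q
    have hmem' : ∀ x, x ∈ S.toList ↔ x ∈ S := fun x => Finset.mem_toList
    rcases exists_succ S.toList q with h | ⟨b, hb, hqb, hbmin⟩
    · have hzq : z ≤ q := h z ((hmem' z).2 hzS)
      rw [linRank_eq_sum (C := finiteDiff f 0 zs)
        fun x hx => h x ((hmem' x).2 ((hC'mem x).1 hx)), hsum, hf,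
        linRank_eq_sum fun x hx => (hzmax x hx).trans hzq, ← hWdef, sub_self, abs_zero]
      exact hτ.le
    simp only [hmem'] at hb hbmin
    rcases exists_pred S.toList q with h | ⟨a, ha, haq, hamax⟩
    · simp only [hmem'] at h
      rw [linRank_eq_zero fun x hx => h x ((hC'mem x).1 hx), sub_zero, abs_of_nonneg (hf0 q)]
      by_contra! hfq
      have hp : ∃ p ∈ pts, p ≤ q := by
        by_contra! hp
        have : f q = 0 := linRank_eq_zero hp
        linarith
      obtain ⟨p, hp, hpq⟩ := hp
      obtain ⟨M, hM⟩ := pts.toFinset.bddBelow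
      have h0 : f (M - 1) = 0 := linRank_eq_zero fun x hx =>
        (sub_one_lt M).trans_le (hM (List.mem_toFinset.2 hx))
      have h1 := hgap (M - 1) b hb (by linarith [hmono hqb.le]) (fun x hx _ => hbmin x hx (h x hx))
        ⟨p, hp, hpq.trans_lt hqb⟩
      have h2 := hpredp b ⟨p, hp, hpq.trans_lt hqb⟩
      exact absurd (hbmin _ h1 (h _ h1)) (not_le.2 h2.1)
    · simp only [hmem'] at ha hamax
      have hab := haq.trans_lt hqb
      have hmin : ∀ x ∈ S, a < x → b ≤ x := by
        intro x hx hax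
        by_contra hxb
        rcases le_or_gt x q with h | h
        · exact absurd (hamax x hx h) (not_le.2 hax)
        · exact hxb (hbmin x hx h)
      have e1 := linRank_affine (C := finiteDiff f 0 zs) (by simpa using hzsort)
        ⟨a, (hC'mem a).2 ha, le_rfl⟩ hab (fun x hx => hmin x ((hC'mem x).1 hx)) haq hqb.le
      rw [hrank a ha, hrank b hb] at e1
      have hapts : a ∈ pts := List.mem_toFinset.1 (hSpts ha)
      by_cases hbig : f a + τ < f b
      · have h1 := hgap a b hb hbig hmin ⟨a, hapts, hab⟩
        have h2 := hpredp b ⟨a, hapts, hab⟩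
        have h3 : pred b ≤ a := by
          by_contra h
          exact absurd (hmin _ h1 (not_le.1 h)) (not_le.2 h2.1)
        have e2 := linRank_affine hC.sorted ⟨a, hapts, le_rfl⟩ hab
          (fun x hx hax => by
            by_contra hxb
            exact absurd ((h2.2 x hx (not_le.1 hxb)).trans h3) (not_le.2 hax)) haq hqb.le
        rw [e1, hf, e2]
        simpa using hτ.le
      · have hd : 0 < b - a := sub_pos.2 hab
        have h1 : (q - a) / (b - a) ≤ 1 := by rw [div_le_one hd]; linarith
        have h2 : 0 ≤ (q - a) / (b - a) := div_nonneg (by linarith) hd.le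
        have h3 := hmono haq
        have h4 := hmono hqb.le
        have h5 := hmono hab.le
        rw [e1, abs_le]
        constructor <;> nlinarith

/-- What an optimal rule achieves on a linear compactor with many points. -/
lemma IsOptimalRule.spec {compact : List (ℝ × ℝ) → List (ℝ × ℝ)} (hr : IsOptimalRule compact)
    {C : List (ℝ × ℝ)} (hC : IsProper C) {τ : ℝ} (hτ : 0 < τ)
    (hW : 8 * (C.map Prod.snd).sum ≤ τ * C.length) (hm : 4 ≤ C.length) :
    IsCompaction C (compact C) ∧ ∀ q, |linRank C q - linRank (compact C) q| ≤ τ := by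
  obtain ⟨C', h1, h2⟩ := exists_isCompaction hC hτ hW hm
  obtain ⟨h3, h4⟩ := hr C (exists_isOptimalCompaction hC.sorted ⟨C', h1⟩)
  refine ⟨h3, fun q => ?_⟩
  have h5 : supLoss C C' ≤ ENNReal.ofReal τ := iSup_le fun q => ENNReal.ofReal_le_ofReal (h2 q)
  have h6 : ENNReal.ofReal |linRank C q - linRank (compact C) q| ≤ supLoss C (compact C) :=
    le_iSup (fun q : ℝ => ENNReal.ofReal |linRank C q - linRank (compact C) q|) q
  exact (ENNReal.ofReal_le_ofReal_iff hτ.le).1 (h6.trans ((h4 C' h1).trans h5))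

/-- A compaction of small loss keeps the first jump small: if points before the new first point
were dropped, the old rank up to this point counts as loss. -/
lemma JumpLE.compaction {D : ℝ} {C C' : List (ℝ × ℝ)} (hC : IsProper C) (hJ : JumpLE D C)
    (h : IsCompaction C C') (hD : 0 ≤ D) (hloss : ∀ q, |linRank C q - linRank C' q| ≤ D) :
    JumpLE D C' := by
  intro b hb
  by_cases hbm : b ∈ C'.map Prod.fst
  · obtain ⟨p, hp, rfl⟩ := List.mem_map.1 hbm
    rw [h.rank_eq p hp]
    rcases exists_pred_lt (C.map Prod.fst) p.1 with h1 | ⟨a, ha, hab, hamax⟩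
    · exact hJ _ h1
    have hq : ∀ q, a ≤ q → q < p.1 → linRank C q ≤ D := by
      intro q _ hqb
      have := hloss q
      rw [linRank_eq_zero (C := C') fun y hy => hqb.trans_le (hb y hy), sub_zero] at this
      exact (le_abs_self _).trans this
    -- the rank is affine, hence continuous from the left at the new first point
    by_contra! hbig
    have hd : 0 < p.1 - a := sub_pos.2 hab
    have ha0 := linRank_nonneg hC.sorted hC.nonneg a
    have haD := hq a le_rfl hab
    set B := linRank C p.1 with hB
    set A := linRank C a with hA
    have hBA : 0 < B - A := by linarith
    set θ := ((D + B) / 2 - A) / (B - A) with hθ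
    have hθ0 : 0 ≤ θ := div_nonneg (by linarith) hBA.le
    have hθ1 : θ < 1 := by rw [hθ, div_lt_one hBA]; linarith
    have e := linRank_affine hC.sorted ⟨a, ha, le_rfl⟩ hab (q := a + θ * (p.1 - a))
      (fun y hy hay => by
        by_contra hyb
        exact absurd (hamax y hy (not_le.1 hyb)) (not_le.2 hay)) (by nlinarith) (by nlinarith)
    have h3 := hq (a + θ * (p.1 - a)) (by nlinarith) (by nlinarith)
    have h4 : (a + θ * (p.1 - a) - a) / (p.1 - a) = θ := by field_simp; ring
    rw [e, h4, ← hA, ← hB, hθ, mul_div_cancel₀ _ hBA.ne'] at h3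
    linarith
  · rw [linRank_eq_zero]
    · exact hD
    · intro y hy
      refine (hb y hy).lt_of_ne ?_
      rintro rfl
      exact hbm hy

/-! ### Expectations and exponential potentials -/

/-- The expectation of a nonnegative function. -/
def expect {α : Type*} (p : PMF α) (F : α → ℝ≥0∞) : ℝ≥0∞ := ∑' a, p a * F a

lemma expect_pure {α : Type*} (a : α) (F : α → ℝ≥0∞) : expect (PMF.pure a) F = F a := by
  rw [expect, tsum_eq_single a fun b hb => by simp [PMF.pure_apply_of_ne _ _ hb]]
  simp

lemma expect_bind {α β : Type*} (p : PMF α) (f : α → PMF β) (F : β → ℝ≥0∞) :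
    expect (p.bind f) F = expect p fun a => expect (f a) F := by
  simp only [expect, PMF.bind_apply, ← ENNReal.tsum_mul_right, ← ENNReal.tsum_mul_left]
  rw [ENNReal.tsum_comm]
  simp only [mul_assoc]

lemma expect_mono {α : Type*} (p : PMF α) {F G : α → ℝ≥0∞} (h : ∀ a, F a ≤ G a) :
    expect p F ≤ expect p G :=
  ENNReal.tsum_le_tsum fun a => mul_le_mul_right (h a) _

lemma expect_const {α : Type*} (p : PMF α) (c : ℝ≥0∞) : expect p (fun _ => c) = c := by
  rw [expect, ENNReal.tsum_mul_right, p.tsum_coe, one_mul]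

lemma expect_uniform {α : Type*} [Fintype α] [Nonempty α] (F : α → ℝ≥0∞) :
    expect (PMF.uniformOfFintype α) F = (Fintype.card α : ℝ≥0∞)⁻¹ * ∑ a, F a := by
  simp only [expect, PMF.uniformOfFintype_apply, tsum_fintype, Finset.mul_sum]

/-- The potential `cosh (lam x) exp (-lam² v / 2)` of an accumulated error `x` whose increments had
a total variance proxy `v`: a supermartingale along the run of the sketch. -/
def potential (lam x v : ℝ) : ℝ≥0∞ :=
  ENNReal.ofReal (Real.cosh (lam * x) * Real.exp (-(lam ^ 2 * v / 2)))

lemma potential_antitone {lam x v v' : ℝ} (h : v ≤ v') :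
    potential lam x v' ≤ potential lam x v := by
  refine ENNReal.ofReal_le_ofReal ?_
  have := Real.cosh_pos (lam * x)
  gcongr

/-- From an accumulated error `x` and variance proxy `v`, the random state drawn from `p` comes
with an updated error `x'` and proxy `v'` that satisfy `R`, and the potential does not grow in
expectation. The pairs `(x', v')` are not part of the state, so this is expressed by
quantifying over the functions `F` of the state that the potential dominates wherever `R` holds. -/
def Reaches {α : Type*} (lam : ℝ) (p : PMF α) (R : α → ℝ → ℝ → Prop) (x v : ℝ) : Prop :=
  ∀ (F : α → ℝ≥0∞) (c : ℝ≥0∞), (∀ a x' v', R a x' v' → F a ≤ c * potential lam x' v') →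
    expect p F ≤ c * potential lam x v

namespace Reaches

variable {α β : Type*} {lam : ℝ}

lemma pure {a : α} {R : α → ℝ → ℝ → Prop} {x v : ℝ} (h : R a x v) :
    Reaches lam (PMF.pure a) R x v := by
  intro F c hF
  rw [expect_pure]
  exact hF a x v h

lemma bind {p : PMF α} {f : α → PMF β} {R : α → ℝ → ℝ → Prop} {R' : β → ℝ → ℝ → Prop} {x v : ℝ}
    (hp : Reaches lam p R x v) (hf : ∀ a x' v', R a x' v' → Reaches lam (f a) R' x' v') :
    Reaches lam (p.bind f) R' x v := by
  intro F c hF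
  rw [expect_bind]
  exact hp _ c fun a x' v' h => hf a x' v' h F c hF

lemma mono {p : PMF α} {R R' : α → ℝ → ℝ → Prop} {x v : ℝ} (hp : Reaches lam p R x v)
    (h : ∀ a x' v', R a x' v' → R' a x' v') : Reaches lam p R' x v :=
  fun F c hF => hp F c fun a x' v' hR => hF a x' v' (h a x' v' hR)

lemma bind_of_forall {p : PMF α} {f : α → PMF β} {R : β → ℝ → ℝ → Prop} {x v : ℝ}
    (hf : ∀ a, Reaches lam (f a) R x v) : Reaches lam (p.bind f) R x v := by
  intro F c hF
  rw [expect_bind]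
  exact (expect_mono p fun a => hf a F c hF).trans (expect_const p _).le

/-- A fair coin that changes the error by `b` or `-b` is paid for by a variance of `b²`. -/
lemma coin {f : Bool → PMF β} {R : β → ℝ → ℝ → Prop} {x v b : ℝ}
    (h : ∀ i, Reaches lam (f i) R (x + if i then b else -b) (v + b ^ 2)) :
    Reaches lam ((PMF.uniformOfFintype Bool).bind f) R x v := by
  intro F c hF
  rw [expect_bind, expect_uniform]
  have h1 := h true F c hF
  have h2 := h false F c hF
  simp only [if_true] at h1
  simp only [Bool.false_eq_true, if_false] at h2
  have key : potential lam (x + b) (v + b ^ 2) + potential lam (x + -b) (v + b ^ 2)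
      ≤ 2 * potential lam x v := by
    have h2' : (2 : ℝ≥0∞) = ENNReal.ofReal 2 := by simp
    rw [potential, potential, potential, h2', ← ENNReal.ofReal_mul (by norm_num),
      ← ENNReal.ofReal_add (by have := Real.cosh_pos (lam * (x + b)); positivity)
        (by have := Real.cosh_pos (lam * (x + -b)); positivity)]
    refine ENNReal.ofReal_le_ofReal ?_
    have e1 : Real.cosh (lam * (x + b)) + Real.cosh (lam * (x + -b))
        = 2 * (Real.cosh (lam * x) * Real.cosh (lam * b)) := by
      rw [mul_add, mul_add, Real.cosh_add, Real.cosh_add, mul_neg, Real.cosh_neg, Real.sinh_neg]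
      ring
    have e2 : Real.exp (-(lam ^ 2 * (v + b ^ 2) / 2))
        = Real.exp (-(lam ^ 2 * v / 2)) * Real.exp (-((lam * b) ^ 2 / 2)) := by
      rw [← Real.exp_add]; congr 1; ring
    have e3 : Real.cosh (lam * b) * Real.exp (-((lam * b) ^ 2 / 2)) ≤ 1 := by
      have := Real.cosh_le_exp_half_sq (lam * b)
      rw [Real.exp_neg, ← div_eq_mul_inv, div_le_one (Real.exp_pos _)]
      exact this
    rw [← add_mul, e1, e2]
    have := Real.cosh_pos (lam * x)
    calc 2 * (Real.cosh (lam * x) * Real.cosh (lam * b))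
          * (Real.exp (-(lam ^ 2 * v / 2)) * Real.exp (-((lam * b) ^ 2 / 2)))
        = 2 * (Real.cosh (lam * x) * Real.exp (-(lam ^ 2 * v / 2)))
          * (Real.cosh (lam * b) * Real.exp (-((lam * b) ^ 2 / 2))) := by ring
      _ ≤ 2 * (Real.cosh (lam * x) * Real.exp (-(lam ^ 2 * v / 2))) * 1 := by gcongr
      _ = _ := by ring
  rw [Fintype.sum_bool, Fintype.card_bool]
  calc ((2 : ℕ) : ℝ≥0∞)⁻¹ * (expect (f true) F + expect (f false) F)
      ≤ 2⁻¹ * (c * (2 * potential lam x v)) := by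
        push_cast
        gcongr
        refine (add_le_add h1 h2).trans ?_
        rw [← mul_add]
        gcongr
    _ = 2⁻¹ * 2 * (c * potential lam x v) := by ring
    _ = c * potential lam x v := by
        rw [ENNReal.inv_mul_cancel (by norm_num) (by norm_num), one_mul]

lemma of_le {p : PMF α} {R : α → ℝ → ℝ → Prop} {x v v' : ℝ} (h : Reaches lam p R x v')
    (hv : v ≤ v') : Reaches lam p R x v :=
  fun F c hF => (h F c hF).trans (mul_le_mul_right (potential_antitone hv) _)

/-- The relation holds, for some error and proxy, at every state of positive probability. -/
lemma of_mem_support {p : PMF α} {R : α → ℝ → ℝ → Prop} {x v : ℝ} (h : Reaches lam p R x v)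
    {a : α} (ha : a ∈ p.support) : ∃ x' v', R a x' v' := by
  classical
  by_contra hne
  have := h (fun b => if b = a then 1 else 0) 0 fun b x' v' hR => by
    rw [if_neg]
    · simp
    · rintro rfl
      exact hne ⟨x', v', hR⟩
  rw [zero_mul, nonpos_iff_eq_zero, expect, ENNReal.tsum_eq_zero] at this
  exact (p.mem_support_iff a).1 ha (by simpa using this a)

/-- The tail bound: if errors beyond `r` are forced wherever the event holds, the event has
probability at most `2 exp (-r² / (2 V))`. -/
lemma measure_le {V r : ℝ} (hV : 0 < V) (hr : 0 < r) {p : PMF α} {R : α → ℝ → ℝ → Prop}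
    (h : Reaches (r / V) p R 0 0) {s : Set α}
    (hs : ∀ a ∈ s, ∀ x v, R a x v → v ≤ V ∧ r ≤ |x|) :
    p.toOuterMeasure s ≤ ENNReal.ofReal (2 * Real.exp (-(r ^ 2 / (2 * V)))) := by
  classical
  have h1 := h (fun a => if a ∈ s then 1 else 0)
    (ENNReal.ofReal (2 * Real.exp (-(r ^ 2 / (2 * V))))) fun a x v hR => by
      split_ifs with ha
      · obtain ⟨hv, hx⟩ := hs a ha x v hR
        rw [potential, ← ENNReal.ofReal_mul (by positivity), ← ENNReal.ofReal_one]
        refine ENNReal.ofReal_le_ofReal ?_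
        have e1 : Real.exp (r ^ 2 / V) / 2 ≤ Real.cosh (r / V * x) := by
          rw [← Real.cosh_abs, abs_mul, abs_of_pos (div_pos hr hV), Real.cosh_eq]
          have : Real.exp (r ^ 2 / V) ≤ Real.exp (r / V * |x|) := by
            refine Real.exp_le_exp.2 ?_
            rw [div_mul_eq_mul_div, pow_two]
            gcongr
          have := Real.exp_pos (-(r / V * |x|))
          linarith
        have e2 : Real.exp (-(r ^ 2 / (2 * V))) ≤ Real.exp (-((r / V) ^ 2 * v / 2)) := by
          refine Real.exp_le_exp.2 (neg_le_neg ?_)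
          have : (r / V) ^ 2 * v ≤ (r / V) ^ 2 * V := by gcongr
          have e : r ^ 2 / (2 * V) = (r / V) ^ 2 * V / 2 := by field_simp
          linarith
        have e3 : Real.exp (-(r ^ 2 / (2 * V))) * Real.exp (-(r ^ 2 / (2 * V)))
            * Real.exp (r ^ 2 / V) = 1 := by
          rw [← Real.exp_add, ← Real.exp_add, Real.exp_eq_one_iff]
          field_simp
          ring
        calc (1 : ℝ) = 2 * Real.exp (-(r ^ 2 / (2 * V)))
              * (Real.exp (r ^ 2 / V) / 2 * Real.exp (-(r ^ 2 / (2 * V)))) := by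
              rw [← e3]; ring
          _ ≤ _ := by gcongr
      · exact zero_le
  have h2 : potential (r / V) 0 0 = 1 := by simp [potential]
  rw [h2, mul_one] at h1
  refine le_trans (le_of_eq ?_) h1
  rw [PMF.toOuterMeasure_apply, expect]
  congr 1
  ext a
  by_cases ha : a ∈ s <;> simp [ha]

end Reaches

lemma cosh_add_le {lam x b y : ℝ} (hb : 0 < b) (hy : |y| ≤ b) :
    Real.cosh (lam * (x + y)) ≤ Real.cosh (lam * x) * Real.cosh (lam * b)
      + y / b * (Real.sinh (lam * x) * Real.sinh (lam * b)) := by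
  obtain ⟨h1, h2⟩ := abs_le.1 hy
  have hexp : ∀ s : ℝ, Real.exp (s * y) ≤ Real.cosh (s * b) + y / b * Real.sinh (s * b) := by
    intro s
    have := convexOn_exp.2 (Set.mem_univ (s * b)) (Set.mem_univ (-(s * b)))
      (div_nonneg (by linarith) (by linarith) : 0 ≤ (b + y) / (2 * b))
      (div_nonneg (by linarith) (by linarith) : 0 ≤ (b - y) / (2 * b)) (by field_simp; ring)
    simp only [smul_eq_mul] at this
    rw [show (b + y) / (2 * b) * (s * b) + (b - y) / (2 * b) * -(s * b) = s * y by
      field_simp; ring] at this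
    refine this.trans (le_of_eq ?_)
    rw [Real.cosh_eq, Real.sinh_eq]
    field_simp
    ring
  have e1 := hexp lam
  have e2 := hexp (-lam)
  rw [neg_mul, neg_mul, Real.cosh_neg, Real.sinh_neg] at e2
  have e3 : Real.cosh (lam * (x + y)) = (Real.exp (lam * x) * Real.exp (lam * y)
      + Real.exp (-(lam * x)) * Real.exp (-(lam * y))) / 2 := by
    rw [Real.cosh_eq, ← Real.exp_add, ← Real.exp_add]
    ring_nf
  rw [e3, Real.cosh_eq (lam * x), Real.sinh_eq (lam * x)]
  have p1 := Real.exp_pos (lam * x)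
  have p2 := Real.exp_pos (-(lam * x))
  nlinarith [mul_le_mul_of_nonneg_left e1 p1.le, mul_le_mul_of_nonneg_left e2 p2.le]

/-- Hoeffding's lemma for the uniform distribution on a list: errors of mean zero, bounded by `b`,
are paid for by a variance of `b²`. -/
lemma sum_potential_le {lam x v b : ℝ} (hb : 0 ≤ b) (us : List ℝ) (ξ : ℝ → ℝ)
    (hξ : ∀ u ∈ us, |ξ u| ≤ b) (hsum : (us.map ξ).sum = 0) :
    (us.map fun u => potential lam (x + ξ u) (v + b ^ 2)).sum ≤ us.length * potential lam x v := by
  have hcosh : (us.map fun u => Real.cosh (lam * (x + ξ u))).sum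
      ≤ us.length * (Real.cosh (lam * x) * Real.cosh (lam * b)) := by
    rcases hb.eq_or_lt with rfl | hb
    · have : ∀ u ∈ us, Real.cosh (lam * (x + ξ u)) ≤ Real.cosh (lam * x) * Real.cosh (lam * 0) := by
        intro u hu
        rw [abs_nonpos_iff.1 (hξ u hu)]
        simp
      refine (List.sum_le_sum this).trans (le_of_eq ?_)
      simp
    · have h1 : (us.map fun u => Real.cosh (lam * (x + ξ u))).sum
          ≤ (us.map fun u => Real.cosh (lam * x) * Real.cosh (lam * b)
            + ξ u * (Real.sinh (lam * x) * Real.sinh (lam * b) / b)).sum := by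
        refine List.sum_le_sum fun u hu => (cosh_add_le hb (hξ u hu)).trans (le_of_eq ?_)
        ring
      refine h1.trans (le_of_eq ?_)
      rw [List.sum_map_add, List.sum_map_mul_right (f := ξ), hsum]
      simp
  set E := Real.exp (-(lam ^ 2 * (v + b ^ 2) / 2)) with hE
  have h1 : (us.map fun u => potential lam (x + ξ u) (v + b ^ 2)).sum
      = ENNReal.ofReal ((us.map fun u => Real.cosh (lam * (x + ξ u))).sum * E) := by
    clear hcosh hsum hξ
    induction us with
    | nil => simp
    | cons u us ih =>
      have h0 : 0 ≤ (us.map fun u => Real.cosh (lam * (x + ξ u))).sum :=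
        List.sum_nonneg fun y hy => by
          obtain ⟨u, -, rfl⟩ := List.mem_map.1 hy
          exact (Real.cosh_pos _).le
      simp only [List.map_cons, List.sum_cons, ih, add_mul]
      rw [ENNReal.ofReal_add (mul_nonneg (Real.cosh_pos _).le (Real.exp_pos _).le)
        (mul_nonneg h0 (Real.exp_pos _).le)]
      rfl
  rw [h1, potential, ← ENNReal.ofReal_natCast, ← ENNReal.ofReal_mul (by positivity)]
  refine ENNReal.ofReal_le_ofReal ?_
  have e2 : E = Real.exp (-(lam ^ 2 * v / 2)) * Real.exp (-((lam * b) ^ 2 / 2)) := by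
    rw [hE, ← Real.exp_add]; congr 1; ring
  have e3 : Real.cosh (lam * b) * Real.exp (-((lam * b) ^ 2 / 2)) ≤ 1 := by
    rw [Real.exp_neg, ← div_eq_mul_inv, div_le_one (Real.exp_pos _)]
    exact Real.cosh_le_exp_half_sq (lam * b)
  have := Real.cosh_pos (lam * x)
  calc (us.map fun u => Real.cosh (lam * (x + ξ u))).sum * E
      ≤ us.length * (Real.cosh (lam * x) * Real.cosh (lam * b)) * E := by gcongr
    _ = us.length * (Real.cosh (lam * x) * Real.exp (-(lam ^ 2 * v / 2)))
        * (Real.cosh (lam * b) * Real.exp (-((lam * b) ^ 2 / 2))) := by rw [e2]; ring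
    _ ≤ us.length * (Real.cosh (lam * x) * Real.exp (-(lam ^ 2 * v / 2))) * 1 := by gcongr
    _ = _ := by ring

/-! ### The sampler -/

lemma expect_step (P : Params) (st : State) (x : ℝ) (us : List ℝ) (F : State → ℝ≥0∞) :
    let T : ℝ → ℝ≥0∞ := fun y => expect ((if st.count + 1 < 2 ^ P.samplerLevels then
      PMF.pure { st with count := st.count + 1, sample := y }
      else feed P (P.levels - P.samplerLevels) [y] { st with count := 0 }).bind
        fun st' => runFrom P st' us) F
    expect (runFrom P st (x :: us)) F
      = ((st.count + 1 : ℕ) : ℝ≥0∞)⁻¹ * (T x + st.count * T st.sample) := by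
  intro T
  rw [runFrom, step, PMF.bind_bind, expect_bind, expect_uniform, Fintype.card_fin,
    Fin.sum_univ_succ]
  have h : ∀ i : Fin st.count, i.succ ≠ 0 := fun i => Fin.succ_ne_zero i
  simp only [h, if_true, if_false, Finset.sum_const, Finset.card_univ, Fintype.card_fin,
    nsmul_eq_mul, T]

/-- The sampler selects a uniformly random item of each block: given the item selected from the
first `st.count` items of a block, it survives with probability `st.count / 2 ^ samplerLevels`,
and each of the remaining items is passed on with probability `1 / 2 ^ samplerLevels`. -/
lemma expect_runFrom_block (P : Params) (F : State → ℝ≥0∞) (φ : ℝ → ℝ≥0∞) (us : List ℝ)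
    (st : State) (hus : us ≠ []) (hlen : st.count + us.length = 2 ^ P.samplerLevels)
    (hφ : ∀ y z, (st.count ≠ 0 ∧ y = st.sample) ∨ y ∈ us →
      expect (feed P (P.levels - P.samplerLevels) [y] { st with count := 0, sample := z }) F
        ≤ φ y) :
    (2 ^ P.samplerLevels : ℕ) * expect (runFrom P st us) F
      ≤ st.count * φ st.sample + (us.map φ).sum := by
  induction us generalizing st with
  | nil => exact absurd rfl hus
  | cons x us ih =>
    rw [expect_step]
    set T : ℝ → ℝ≥0∞ := fun y => expect ((if st.count + 1 < 2 ^ P.samplerLevels then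
      PMF.pure { st with count := st.count + 1, sample := y }
      else feed P (P.levels - P.samplerLevels) [y] { st with count := 0 }).bind
        fun st' => runFrom P st' us) F with hT
    have hcancel : ((st.count + 1 : ℕ) : ℝ≥0∞)⁻¹ * (st.count + 1 : ℕ) = 1 :=
      ENNReal.inv_mul_cancel (by simp) (by simp)
    by_cases hus' : us = []
    · subst hus'
      have hB : st.count + 1 = 2 ^ P.samplerLevels := by simpa using hlen
      have hTφ : ∀ y, (st.count ≠ 0 ∧ y = st.sample) ∨ y ∈ [x] → T y ≤ φ y := by
        intro y hy
        have := hφ y st.sample hy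
        simp only [hT, hB, lt_irrefl, if_false, runFrom]
        rwa [PMF.bind_pure]
      have h1 := hTφ x (by simp)
      have h2 : st.count * T st.sample ≤ st.count * φ st.sample := by
        rcases Nat.eq_zero_or_pos st.count with h | h
        · simp [h]
        · exact mul_le_mul_right (hTφ _ (Or.inl ⟨h.ne', rfl⟩)) _
      rw [← hB, ← mul_assoc, mul_comm ((st.count + 1 : ℕ) : ℝ≥0∞), hcancel, one_mul]
      simpa [add_comm] using add_le_add h1 h2
    · have hlen' : st.count + 1 + us.length = 2 ^ P.samplerLevels := by
        rw [← hlen, List.length_cons]; ring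
      have hB : st.count + 1 < 2 ^ P.samplerLevels := by
        have := List.length_pos_iff.2 hus'
        omega
      have hTφ : ∀ y, (st.count ≠ 0 ∧ y = st.sample) ∨ y = x →
          (2 ^ P.samplerLevels : ℕ) * T y
            ≤ ((st.count + 1 : ℕ) : ℝ≥0∞) * φ y + (us.map φ).sum := by
        intro y hy
        have := ih { st with count := st.count + 1, sample := y } hus' hlen' fun u z hu => by
          refine hφ u z ?_
          rcases hu with ⟨-, rfl⟩ | hu
          · exact hy.imp id fun h => by simp [h]
          · exact Or.inr (by simp [hu])
        simp only [hT, if_pos hB, PMF.pure_bind]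
        exact this
      have h1 := hTφ x (Or.inr rfl)
      have h2 : st.count * ((2 ^ P.samplerLevels : ℕ) * T st.sample)
          ≤ st.count * (((st.count + 1 : ℕ) : ℝ≥0∞) * φ st.sample + (us.map φ).sum) := by
        rcases Nat.eq_zero_or_pos st.count with h | h
        · simp [h]
        · exact mul_le_mul_right (hTφ _ (Or.inl ⟨h.ne', rfl⟩)) _
      set S := (us.map φ).sum
      calc ((2 ^ P.samplerLevels : ℕ) : ℝ≥0∞)
            * (((st.count + 1 : ℕ) : ℝ≥0∞)⁻¹ * (T x + st.count * T st.sample))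
          = ((st.count + 1 : ℕ) : ℝ≥0∞)⁻¹ * ((2 ^ P.samplerLevels : ℕ) * T x
              + st.count * ((2 ^ P.samplerLevels : ℕ) * T st.sample)) := by ring
        _ ≤ ((st.count + 1 : ℕ) : ℝ≥0∞)⁻¹ * (((st.count + 1 : ℕ) * φ x + S)
              + st.count * ((st.count + 1 : ℕ) * φ st.sample + S)) := by gcongr
        _ = ((st.count + 1 : ℕ) : ℝ≥0∞)⁻¹ * (st.count + 1 : ℕ)
              * (st.count * φ st.sample + (φ x + S)) := by push_cast; ring
        _ = _ := by rw [hcancel, one_mul, List.map_cons, List.sum_cons]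

lemma rank_append (xs ys : List ℝ) (q : ℝ) : rank (xs ++ ys) q = rank xs q + rank ys q :=
  List.countP_append

/-- Passing on one random item, with the weight of the whole block, changes the error by less than
the length of the block, and by nothing in expectation. -/
lemma reaches_block {lam : ℝ} {P : Params} {us : List ℝ} (hus : us.length = 2 ^ P.samplerLevels)
    {st : State} (hst : st.count = 0) {R : State → ℝ → ℝ → Prop} {x v : ℝ} (q : ℝ)
    (h : ∀ y ∈ us, ∀ z,
      Reaches lam (feed P (P.levels - P.samplerLevels) [y] { st with count := 0, sample := z }) R
        (x + (2 ^ P.samplerLevels * (if y ≤ q then 1 else 0) - rank us q))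
        (v + (2 ^ P.samplerLevels - 1) ^ 2)) :
    Reaches lam (runFrom P st us) R x v := by
  intro F c hF
  have hB1 : (1 : ℝ) ≤ 2 ^ P.samplerLevels := one_le_pow₀ one_le_two
  have hne : us ≠ [] := by
    rw [← List.length_pos_iff, hus]; positivity
  set ξ : ℝ → ℝ := fun y => 2 ^ P.samplerLevels * (if y ≤ q then 1 else 0) - rank us q with hξ
  have h1 := expect_runFrom_block P F
    (fun y => c * potential lam (x + ξ y) (v + (2 ^ P.samplerLevels - 1) ^ 2)) us st hne
    (by rw [hst, zero_add, hus]) fun y z hy => by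
      rcases hy with ⟨h0, -⟩ | hy
      · exact absurd hst h0
      · exact h y hy z F c hF
  rw [hst, Nat.cast_zero, zero_mul, zero_add, List.sum_map_mul_left] at h1
  have hlenR : (us.length : ℝ) = 2 ^ P.samplerLevels := by rw [hus]; push_cast; rfl
  have h2 := sum_potential_le (lam := lam) (x := x) (v := v) (sub_nonneg.2 hB1) us ξ
    (fun y hy => by
      simp only [hξ]
      split_ifs with hyq
      · have h1 : 1 ≤ rank us q :=
          List.countP_pos_iff.2 ⟨y, hy, by simpa using hyq⟩
        have h2 : rank us q ≤ us.length := List.countP_le_length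
        have h1' : (1 : ℝ) ≤ rank us q := by exact_mod_cast h1
        have h2' : (rank us q : ℝ) ≤ 2 ^ P.samplerLevels := by rw [← hlenR]; exact_mod_cast h2
        rw [abs_le]; constructor <;> linarith
      · have h2 : rank us q < us.length := by
          refine lt_of_le_of_ne List.countP_le_length fun he => hyq ?_
          simpa using List.countP_eq_length.1 he y hy
        have h2' : (rank us q : ℝ) + 1 ≤ 2 ^ P.samplerLevels := by
          rw [← hlenR]; exact_mod_cast h2
        have h3 : (0 : ℝ) ≤ rank us q := by positivity
        rw [abs_le]; constructor <;> linarith)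
    (by
      have e : ∀ l : List ℝ, (l.map fun y => if y ≤ q then (1 : ℝ) else 0).sum = rank l q := by
        intro l
        induction l with
        | nil => simp [rank]
        | cons a l ih =>
          simp only [List.map_cons, List.sum_cons, ih, rank, List.countP_cons, decide_eq_true_eq]
          push_cast
          ring
      have e2 : (us.map ξ).sum = (us.map fun y => 2 ^ P.samplerLevels *
          (if y ≤ q then (1 : ℝ) else 0) + -(rank us q : ℝ)).sum := by
        simp only [hξ, sub_eq_add_neg]
      rw [e2, List.sum_map_add, List.sum_map_mul_left, e]
      simp [hlenR])
  rw [hus] at h2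
  have h3 := h1.trans (mul_le_mul_right h2 c)
  rw [mul_left_comm] at h3
  exact (ENNReal.mul_le_mul_iff_right (by simp) (by finiteness)).1 h3

/-! ### Compaction of a KLL compactor -/

lemma length_alternate (i : Bool) (l : List ℝ) :
    (alternate i l).length = if i then (l.length + 1) / 2 else l.length / 2 := by
  induction l generalizing i with
  | nil => cases i <;> rfl
  | cons x l ih =>
    cases i
    · simpa [alternate] using ih true
    · simp only [alternate, List.length_cons, ih, Bool.false_eq_true, if_false, if_true]
      omega

lemma alternate_sublist (i : Bool) (l : List ℝ) : (alternate i l).Sublist l := by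
  induction l generalizing i with
  | nil => cases i <;> exact List.Sublist.refl _
  | cons x l ih =>
    cases i
    · exact (ih true).cons x
    · exact (ih false).cons_cons x

lemma countP_alternate (q : ℝ) (i : Bool) {l : List ℝ} (hl : l.Pairwise (· ≤ ·)) :
    (alternate i l).countP (fun x => decide (x ≤ q))
      = if i then (l.countP (fun x => decide (x ≤ q)) + 1) / 2
        else l.countP (fun x => decide (x ≤ q)) / 2 := by
  induction l generalizing i with
  | nil => cases i <;> simp [alternate]
  | cons x l ih =>
    have hl' := (List.pairwise_cons.1 hl).2
    by_cases hx : x ≤ q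
    · cases i
      · simp [alternate, ih true hl', hx]
      · simp only [alternate, List.countP_cons, ih false hl', hx, decide_true, if_true,
          Bool.false_eq_true, if_false]
        omega
    · have h0 : (x :: l).countP (fun x => decide (x ≤ q)) = 0 := by
        refine List.countP_eq_zero.2 fun z hz => ?_
        simp only [decide_eq_true_eq, not_le] at hx ⊢
        rcases List.mem_cons.1 hz with rfl | hz
        · exact hx
        · exact hx.trans_le ((List.pairwise_cons.1 hl).1 z hz)
      have h1 : (alternate i (x :: l)).countP (fun x => decide (x ≤ q)) = 0 :=
        Nat.le_zero.1 (h0 ▸ (alternate_sublist i (x :: l)).countP_le)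
      rw [h0, h1]
      cases i <;> rfl

/-- Doubling the weight of every other item of a sorted list changes the rank of `q` by `±1`,
depending on the choice, if the rank is odd, and not at all if it is even. -/
lemma two_mul_countP_alternate_sub (q : ℝ) (i : Bool) (l : List ℝ) :
    (2 : ℝ) * (alternate i (l.insertionSort (· ≤ ·))).countP (fun x => decide (x ≤ q))
        - l.countP (fun x => decide (x ≤ q))
      = if i then ((l.countP (fun x => decide (x ≤ q)) % 2 : ℕ) : ℝ)
        else -((l.countP (fun x => decide (x ≤ q)) % 2 : ℕ) : ℝ) := by
  rw [countP_alternate q i (List.pairwise_insertionSort _ l),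
    (List.perm_insertionSort (· ≤ ·) l).countP_eq]
  generalize l.countP (fun x => decide (x ≤ q)) = r
  have h := Nat.div_add_mod r 2
  cases i
  · have : (r : ℝ) = 2 * (r / 2 : ℕ) + (r % 2 : ℕ) := by exact_mod_cast h.symm
    simp only [Bool.false_eq_true, if_false]
    linarith
  · have h' : 2 * ((r + 1) / 2) = r + r % 2 := by omega
    have : (2 : ℝ) * ((r + 1) / 2 : ℕ) = r + (r % 2 : ℕ) := by exact_mod_cast h'
    simp only [if_true]
    linarith

/-! ### Capacities and the height of the hierarchy -/

section
variable {k s : ℕ} {c : ℝ} {H n : ℕ}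

lemma capacity_of_le {h : ℕ} (hh : H ≤ h + s) : capacity k s c H h = k := if_pos hh

lemma capacity_of_lt {h : ℕ} (hh : h + s < H) :
    capacity k s c H h = 2 * ⌈max ((k : ℝ) * c ^ (H - h)) 2 / 2⌉₊ := if_neg (not_le.2 hh)

lemma two_mul_capacity_div_two (hk : 2 * (k / 2) = k) (h : ℕ) :
    2 * (capacity k s c H h / 2) = capacity k s c H h := by
  rcases le_or_gt H (h + s) with hh | hh
  · rw [capacity_of_le hh, hk]
  · rw [capacity_of_lt hh]; omega

lemma two_le_capacity (hk : 2 ≤ k) (h : ℕ) : 2 ≤ capacity k s c H h := by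
  rcases le_or_gt H (h + s) with hh | hh
  · rwa [capacity_of_le hh]
  · rw [capacity_of_lt hh]
    have : 0 < ⌈max ((k : ℝ) * c ^ (H - h)) 2 / 2⌉₊ :=
      Nat.ceil_pos.2 (by have := le_max_right ((k : ℝ) * c ^ (H - h)) 2; linarith)
    omega

lemma capacity_le (hc : 0 < c) (hc' : c < 1) (hk : 2 * (k / 2) = k) (hk2 : 2 ≤ k) (h : ℕ) :
    capacity k s c H h ≤ k := by
  rcases le_or_gt H (h + s) with hh | hh
  · rw [capacity_of_le hh]
  · rw [capacity_of_lt hh]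
    have hk' : (2 : ℝ) * (k / 2 : ℕ) = k := by exact_mod_cast hk
    have hk2' : (2 : ℝ) ≤ k := by exact_mod_cast hk2
    have h1 : (k : ℝ) * c ^ (H - h) ≤ k := by
      have := pow_le_one₀ hc.le hc'.le (n := H - h)
      nlinarith
    have : ⌈max ((k : ℝ) * c ^ (H - h)) 2 / 2⌉₊ ≤ k / 2 := by
      refine Nat.ceil_le.2 ?_
      have := max_le h1 hk2'
      linarith
    omega

lemma capacity_mono (hc : 0 < c) (hc' : c < 1) (hk : 2 * (k / 2) = k) (hk2 : 2 ≤ k) (h : ℕ) :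
    capacity k s c H h ≤ capacity k s c H (h + 1) := by
  rcases le_or_gt H (h + 1 + s) with hh | hh
  · rw [capacity_of_le hh]
    exact capacity_le hc hc' hk hk2 h
  · rw [capacity_of_lt hh, capacity_of_lt (by omega)]
    have : c ^ (H - h) ≤ c ^ (H - (h + 1)) := pow_le_pow_of_le_one hc.le hc'.le (by omega)
    gcongr

lemma mul_pow_le_capacity {h : ℕ} (hh : h + s < H) :
    (k : ℝ) * c ^ (H - h) ≤ capacity k s c H h := by
  rw [capacity_of_lt hh]
  have h1 := Nat.le_ceil (max ((k : ℝ) * c ^ (H - h)) 2 / 2)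
  have h2 := le_max_left ((k : ℝ) * c ^ (H - h)) 2
  push_cast
  linarith

lemma capacity_le_two_mul {h : ℕ} (hh : h + s < H) (h2 : 2 < capacity k s c H h) :
    (capacity k s c H h : ℝ) ≤ 2 * (k * c ^ (H - h)) := by
  rw [capacity_of_lt hh] at h2 ⊢
  have h3 : 1 < ⌈max ((k : ℝ) * c ^ (H - h)) 2 / 2⌉₊ := by omega
  have h4 : 2 < (k : ℝ) * c ^ (H - h) := by
    have := Nat.lt_ceil.1 h3
    push_cast at this
    rcases lt_max_iff.1 (show 2 < max ((k : ℝ) * c ^ (H - h)) 2 by linarith) with h | h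
    · exact h
    · exact absurd h (lt_irrefl _)
  have h5 := Nat.ceil_lt_add_one (a := max ((k : ℝ) * c ^ (H - h)) 2 / 2)
    (by have := le_max_right ((k : ℝ) * c ^ (H - h)) 2; linarith)
  rw [max_eq_left h4.le] at h5 ⊢
  push_cast
  linarith

lemma two_pow_mul_arrivals_le (heven : ∀ h, 2 * (capacity k s c H h / 2) = capacity k s c H h)
    (h : ℕ) : 2 ^ h * arrivals k s c H n h ≤ n := by
  induction h with
  | zero => simp [arrivals]
  | succ h ih =>
    rw [arrivals]
    have h1 := heven h
    have h2 := Nat.mul_div_le (arrivals k s c H n h) (capacity k s c H h)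
    set a := arrivals k s c H n h
    set b := capacity k s c H h
    calc 2 ^ (h + 1) * (b / 2 * (a / b)) = 2 ^ h * (2 * (b / 2) * (a / b)) := by ring
      _ = 2 ^ h * (b * (a / b)) := by rw [h1]
      _ ≤ 2 ^ h * a := by gcongr
      _ ≤ n := ih

lemma le_two_pow_mul_arrivals_add (hc : 0 < c) (hc' : c < 1) (hk : 2 * (k / 2) = k) (hk2 : 2 ≤ k)
    (h : ℕ) : n ≤ 2 ^ h * (arrivals k s c H n h + k) := by
  induction h with
  | zero => simp [arrivals]
  | succ h ih =>
    rw [arrivals]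
    have h1 := two_mul_capacity_div_two (s := s) (c := c) (H := H) hk h
    have h2 := capacity_le (s := s) (H := H) hc hc' hk hk2 h
    have h3 := two_le_capacity (s := s) (c := c) (H := H) hk2 h
    set a := arrivals k s c H n h
    set b := capacity k s c H h
    have h4 : a < b * (a / b) + b := by
      have := Nat.div_add_mod a b
      have := Nat.mod_lt a (show 0 < b by omega)
      omega
    calc n ≤ 2 ^ h * (a + k) := ih
      _ ≤ 2 ^ h * (b * (a / b) + 2 * k) := Nat.mul_le_mul_left _ (by omega)
      _ = 2 ^ h * (2 * (b / 2) * (a / b) + 2 * k) := by rw [h1]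
      _ = 2 ^ (h + 1) * (b / 2 * (a / b) + k) := by ring

lemma kllHeight_spec (hk : 2 * (k / 2) = k) (hk2 : 2 ≤ k) :
    1 ≤ kllHeight k s c n ∧ arrivals k s c (kllHeight k s c n) n (kllHeight k s c n - 1)
      < capacity k s c (kllHeight k s c n) (kllHeight k s c n - 1) := by
  refine Nat.sInf_mem (s := {H | 1 ≤ H ∧ arrivals k s c H n (H - 1) < capacity k s c H (H - 1)})
    ⟨n + 1, by omega, ?_⟩
  have h1 := two_pow_mul_arrivals_le (n := n) (two_mul_capacity_div_two (s := s) (c := c)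
    (H := n + 1) hk) n
  have h2 := two_le_capacity (s := s) (c := c) (H := n + 1) hk2 n
  have h3 : n < 2 ^ n := Nat.lt_two_pow_self
  rw [Nat.add_sub_cancel]
  by_contra h
  nlinarith

lemma le_mul_two_pow_kllHeight (hc : 0 < c) (hc' : c < 1) (hk : 2 * (k / 2) = k) (hk2 : 2 ≤ k) :
    n ≤ k * 2 ^ kllHeight k s c n := by
  obtain ⟨h1, h2⟩ := kllHeight_spec (s := s) (c := c) (n := n) hk hk2
  have h3 := le_two_pow_mul_arrivals_add (s := s) (H := kllHeight k s c n) (n := n) hc hc' hk hk2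
    (kllHeight k s c n - 1)
  have h4 := capacity_le (s := s) (H := kllHeight k s c n) hc hc' hk hk2 (kllHeight k s c n - 1)
  refine h3.trans ?_
  obtain ⟨j, hj⟩ : ∃ j, kllHeight k s c n = j + 1 := ⟨_, (Nat.sub_add_cancel h1).symm⟩
  rw [hj] at h2 h4 ⊢
  rw [Nat.add_sub_cancel] at *
  calc 2 ^ j * (arrivals k s c (j + 1) n j + k) ≤ 2 ^ j * (k + k) := by gcongr; omega
    _ = k * 2 ^ (j + 1) := by ring

/-- A hierarchy of height more than `1` is not higher than necessary. -/
lemma two_pow_kllHeight_mul_le (hk : 2 * (k / 2) = k) (hs : 1 ≤ s)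
    (hH : 1 < kllHeight k s c n) : 2 ^ kllHeight k s c n * k ≤ 4 * n := by
  obtain ⟨j, hj⟩ : ∃ j, kllHeight k s c n = j + 2 := ⟨_, (Nat.sub_add_cancel hH).symm⟩
  have h1 : j + 1 < kllHeight k s c n := by omega
  have h2 := Nat.notMem_of_lt_sInf
    (s := {H | 1 ≤ H ∧ arrivals k s c H n (H - 1) < capacity k s c H (H - 1)}) h1
  have h3 : ¬ arrivals k s c (j + 1) n j < capacity k s c (j + 1) j := fun h =>
    h2 ⟨by omega, by simpa using h⟩
  rw [capacity_of_le (by omega), not_lt] at h3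
  have h4 := two_pow_mul_arrivals_le (n := n) (two_mul_capacity_div_two (s := s) (c := c)
    (H := j + 1) hk) j
  rw [hj]
  calc 2 ^ (j + 2) * k = 4 * (2 ^ j * k) := by ring
    _ ≤ 4 * (2 ^ j * arrivals k s c (j + 1) n j) := by gcongr
    _ ≤ 4 * n := by gcongr

end

/-! ### The invariant of a run -/

/-- What the error analysis needs to know about the parameters, for streams of length at most `n`.
The number `D` bounds the weight of an item of the linear compactor and the loss of a compaction
of it. -/
structure Params.Admissible (P : Params) (n : ℕ) (D : ℝ) : Prop where
  rule : IsOptimalRule P.compact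
  lt : P.samplerLevels < P.levels
  even : ∀ h, 2 * (P.cap h / 2) = P.cap h
  two_le : ∀ h, 2 ≤ P.cap h
  cap_le : ∀ h, P.cap h ≤ P.k
  cap_mono : ∀ h, P.cap h ≤ P.cap (h + 1)
  cap_top : P.cap (P.levels - 1) = P.k
  four_le : 4 ≤ P.k
  /-- Without a linear compactor, the top KLL compactor never fills up. -/
  top : P.replaced = 0 →
    arrivals P.k P.s P.c P.H n (P.levels - 1) < P.cap (P.levels - 1)
  weight_le : 0 < P.replaced → (2 : ℝ) ^ P.levels ≤ D
  pos : 0 < D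
  loss_le : 8 * (n : ℝ) ≤ D * P.k

/-- The number of items that have arrived at height `h` when the sampler has passed on `N` items
and the compactor at height `h` has been compacted `m h` times. -/
def inflow (P : Params) (N : ℕ) (m : ℕ → ℕ) (h : ℕ) : ℕ :=
  if h = P.samplerLevels then N else P.cap (h - 1) / 2 * m (h - 1)

/-- The variance proxy of the random errors of the sampler and of the compactors below the top `s`
heights. -/
def variance (P : Params) (N : ℕ) (m : ℕ → ℕ) : ℝ :=
  N * (2 ^ P.samplerLevels - 1) ^ 2
    + ∑ h ∈ Finset.Ico P.samplerLevels P.levels,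
        if h + P.s < P.H then (m h : ℝ) * ((2 : ℝ) ^ h) ^ 2 else 0

/-- The largest possible error of the KLL compactors at the top `s` heights and of the linear
compactor, which receives a batch at each compaction of the level below it. -/
def drift (P : Params) (D : ℝ) (m : ℕ → ℕ) : ℝ :=
  (∑ h ∈ Finset.Ico P.samplerLevels P.levels,
        if h + P.s < P.H then 0 else (2 : ℝ) ^ h * m h)
    + 3 * D * m (P.levels - 1)

/-- The weight of the items `≤ q` in the KLL compactors and the linear compactor. -/
def stored (P : Params) (st : State) (q : ℝ) : ℝ :=
  ∑ h ∈ Finset.Ico P.samplerLevels P.levels,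
        (2 : ℝ) ^ h * ((st.buffer h).countP fun x => decide (x ≤ q))
    + linRank st.linear q

/-- The invariant while a `batch` is on its way to height `h₀`, after the sampler has passed on
`N` items from the blocks that make up `zs`, and the compactor at height `h` has been compacted
`m h` times. The error is `x` up to the drift; a batch on its way to the linear compactor has not
yet used its share `3 D` of the drift. -/
structure Inv (P : Params) (D q : ℝ) (zs : List ℝ) (N : ℕ) (m : ℕ → ℕ) (h₀ : ℕ)
    (batch : List ℝ) (st : State) (x : ℝ) : Prop where
  flow : ∀ h, P.samplerLevels ≤ h → h < P.levels →
    (st.buffer h).length + (if h = h₀ then batch.length else 0) + P.cap h * m h = inflow P N m h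
  short : ∀ h, P.samplerLevels ≤ h → h < P.levels → (st.buffer h).length < P.cap h
  items : (batch : Multiset ℝ)
    + ∑ h ∈ Finset.Ico P.samplerLevels P.levels, (st.buffer h : Multiset ℝ)
    + (st.linear.map Prod.fst : Multiset ℝ) ≤ (zs : Multiset ℝ)
  proper : IsProper st.linear
  jump : JumpLE D st.linear
  weight : (st.linear.map Prod.snd).sum
      + (if h₀ = P.levels then (2 : ℝ) ^ P.levels * batch.length else 0)
    = 2 ^ P.levels * (P.k / 2 * m (P.levels - 1) : ℕ)
  length_le : st.linear.length ≤ P.replaced * P.k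
  err : |2 ^ h₀ * (batch.countP fun x => decide (x ≤ q)) + stored P st q - rank zs q - x|
      + (if h₀ = P.levels then 3 * D else 0) ≤ drift P D m

section
variable {P : Params} {n : ℕ} {D : ℝ}

lemma cap_eq_two (hP : P.Admissible n D) {h : ℕ} (hh : h < P.samplerLevels) : P.cap h = 2 :=
  le_antisymm (not_lt.1 (Nat.notMem_of_lt_sInf (s := {h | 2 < P.cap h}) hh)) (hP.two_le h)

lemma arrivals_succ (P : Params) (n h : ℕ) : arrivals P.k P.s P.c P.H n (h + 1)
    = P.cap h / 2 * (arrivals P.k P.s P.c P.H n h / P.cap h) := rfl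

lemma arrivals_samplerLevels (hP : P.Admissible n D) {h : ℕ} (hh : h ≤ P.samplerLevels) :
    arrivals P.k P.s P.c P.H n h = n / 2 ^ h := by
  induction h with
  | zero => simp [arrivals]
  | succ h ih =>
    rw [arrivals_succ, ih (by omega), cap_eq_two hP (by omega), pow_succ, Nat.div_div_eq_div_mul]
    simp

/-- The sketch never has more arrivals at a height than the KLL sketch on the whole stream. -/
lemma inflow_le (hP : P.Admissible n D) {N : ℕ} (hN : N * 2 ^ P.samplerLevels ≤ n) {m : ℕ → ℕ}
    (hm : ∀ h, P.samplerLevels ≤ h → h < P.levels → P.cap h * m h ≤ inflow P N m h) {h : ℕ}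
    (h1 : P.samplerLevels ≤ h) (h2 : h < P.levels) :
    inflow P N m h ≤ arrivals P.k P.s P.c P.H n h := by
  induction h, h1 using Nat.le_induction with
  | base =>
    rw [inflow, if_pos rfl, arrivals_samplerLevels hP le_rfl]
    exact (Nat.le_div_iff_mul_le (by positivity)).2 hN
  | succ h h1 ih =>
    rw [inflow, if_neg (by omega), arrivals_succ, Nat.add_sub_cancel]
    refine Nat.mul_le_mul_left _ ((Nat.le_div_iff_mul_le (by have := hP.two_le h; omega)).2 ?_)
    rw [mul_comm]
    exact (hm h h1 (by omega)).trans (ih (by omega))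

lemma two_pow_mul_cap_mul_le (hP : P.Admissible n D) {N : ℕ} (hN : N * 2 ^ P.samplerLevels ≤ n)
    {m : ℕ → ℕ}
    (hm : ∀ h, P.samplerLevels ≤ h → h < P.levels → P.cap h * m h ≤ inflow P N m h) {h : ℕ}
    (h1 : P.samplerLevels ≤ h) (h2 : h < P.levels) : 2 ^ h * (P.cap h * m h) ≤ n :=
  (Nat.mul_le_mul_left _ ((hm h h1 h2).trans (inflow_le hP hN hm h1 h2))).trans
    (two_pow_mul_arrivals_le hP.even h)

lemma Inv.cap_mul_le {q : ℝ} {zs : List ℝ} {N : ℕ} {m : ℕ → ℕ} {h₀ : ℕ} {batch : List ℝ}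
    {st : State} {x : ℝ} (I : Inv P D q zs N m h₀ batch st x) (h : ℕ) (h1 : P.samplerLevels ≤ h)
    (h2 : h < P.levels) : P.cap h * m h ≤ inflow P N m h := by
  have := I.flow h h1 h2
  omega

/-- The total weight received by the linear compactor. -/
lemma linear_weight_le (hP : P.Admissible n D) {N : ℕ} (hN : N * 2 ^ P.samplerLevels ≤ n)
    {m : ℕ → ℕ}
    (hm : ∀ h, P.samplerLevels ≤ h → h < P.levels → P.cap h * m h ≤ inflow P N m h) :
    (2 : ℝ) ^ P.levels * (P.k / 2 * m (P.levels - 1) : ℕ) ≤ n := by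
  have hlt := hP.lt
  have h1 := two_pow_mul_cap_mul_le hP hN hm (h := P.levels - 1) (by omega) (by omega)
  have h2 := hP.even (P.levels - 1)
  rw [hP.cap_top] at h1 h2
  have h3 : 2 ^ P.levels * (P.k / 2 * m (P.levels - 1))
      = 2 ^ (P.levels - 1) * (P.k * m (P.levels - 1)) := by
    conv_rhs => rw [← h2]
    conv_lhs => rw [← Nat.sub_add_cancel (show 1 ≤ P.levels by omega), pow_succ]
    simp only [Nat.add_sub_cancel]
    ring
  rw [← h3] at h1
  exact_mod_cast h1

/-- The linear compactor handles a batch with an error of at most `3 D`: `D` each for the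
interpolation in the batch, for merging the lists, and for the compaction. -/
lemma inv_receive (hP : P.Admissible n D) (hr : 0 < P.replaced) {q : ℝ} {zs : List ℝ}
    (hzs : zs.Nodup) {N : ℕ} (hN : N * 2 ^ P.samplerLevels ≤ n) {m : ℕ → ℕ} {batch : List ℝ}
    {st : State} {x : ℝ} (I : Inv P D q zs N m P.levels batch st x) (hb : batch.length ≤ P.k) :
    Inv P D q zs N m P.samplerLevels [] { st with linear := receive P st.linear batch } x := by
  have hlt := hP.lt
  have hw : (0 : ℝ) ≤ 2 ^ P.levels := by positivity
  have hwD := hP.weight_le hr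
  have hD := hP.pos
  have hnd : (st.linear.map Prod.fst ++ batch).Nodup := by
    rw [← Multiset.coe_nodup]
    refine Multiset.nodup_of_le (le_trans ?_ I.items) (Multiset.coe_nodup.2 hzs)
    rw [← Multiset.coe_add, add_comm, add_right_comm]
    exact Multiset.le_add_right _ _
  set C₁ := linAdd st.linear (2 ^ P.levels) batch with hC₁
  have hproper := isProper_linAdd I.proper hw hnd
  have hjump := I.jump.linAdd hw hwD hnd
  have hsum := sum_linAdd (w := 2 ^ P.levels) hnd
  have herr := abs_linRank_linAdd_sub_le I.proper I.jump hw hwD hnd q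
  have herr' := abs_linRank_batchList_sub_le hw (List.nodup_append.1 hnd).2.1 q
  have hlen := length_linAdd st.linear (2 ^ P.levels) batch
  have hfst := map_fst_linAdd st.linear (2 ^ P.levels) batch
  rw [← hC₁] at hproper hjump hsum herr hlen hfst
  have hweight := I.weight
  rw [if_pos rfl] at hweight
  have hItems : (st.linear.map Prod.fst ++ batch : Multiset ℝ) = (C₁.map Prod.fst : Multiset ℝ) := by
    rw [hfst]
    exact Multiset.coe_eq_coe.2 (List.perm_insertionSort _ _).symm
  -- properties of the linear compactor after the optional compaction
  have key : IsProper (receive P st.linear batch) ∧ JumpLE D (receive P st.linear batch) ∧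
      ((receive P st.linear batch).map Prod.fst : Multiset ℝ) ≤ (C₁.map Prod.fst : Multiset ℝ) ∧
      ((receive P st.linear batch).map Prod.snd).sum = (C₁.map Prod.snd).sum ∧
      (receive P st.linear batch).length ≤ P.replaced * P.k ∧
      |linRank C₁ q - linRank (receive P st.linear batch) q| ≤ D := by
    have hk : P.k ≤ P.replaced * P.k := Nat.le_mul_of_pos_left _ hr
    have hlen0 := I.length_le
    rw [receive, ← hC₁]
    split_ifs with hfull
    · have hkC : P.k ≤ C₁.length := hk.trans hfull
      have hkC' : (P.k : ℝ) ≤ C₁.length := by exact_mod_cast hkC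
      obtain ⟨h1, h2⟩ := hP.rule.spec hproper hD (by
        have h3 := linear_weight_le hP hN I.cap_mul_le
        have h4 := hP.loss_le
        rw [hsum, hweight]
        nlinarith) (hP.four_le.trans hkC)
      refine ⟨h1.isProper hproper, hjump.compaction hproper h1 hD.le h2, h1.sublist.subperm,
        h1.weight_eq, ?_, h2 q⟩
      rw [h1.length_eq]
      omega
    · exact ⟨hproper, hjump, le_rfl, rfl, by omega, by simpa using hD.le⟩
  obtain ⟨k1, k2, k3, k4, k5, k6⟩ := key
  refine ⟨?_, I.short, ?_, k1, k2, ?_, k5, ?_⟩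
  · intro h h1 h2
    have := I.flow h h1 h2
    rw [if_neg h2.ne] at this
    simpa using this
  · refine le_trans ?_ I.items
    rw [← hItems, ← Multiset.coe_add] at k3
    have := add_le_add_right k3
      (∑ h ∈ Finset.Ico P.samplerLevels P.levels, (st.buffer h : Multiset ℝ))
    simp only [Multiset.coe_nil, zero_add]
    refine this.trans (le_of_eq ?_)
    abel
  · simp only [k4, hsum, hweight, if_neg hlt.ne, add_zero]
  · have h1 := I.err
    rw [if_pos rfl] at h1
    rw [if_neg hlt.ne, add_zero]
    simp only [stored, List.countP_nil, Nat.cast_zero, mul_zero, zero_add] at h1 ⊢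
    refine le_trans ?_ h1
    rw [abs_le] at *
    have h2 := neg_abs_le (2 ^ P.levels * ((batch.countP fun x => decide (x ≤ q) : ℕ) : ℝ)
      + (∑ h ∈ Finset.Ico P.samplerLevels P.levels,
        (2 : ℝ) ^ h * ((st.buffer h).countP fun x => decide (x ≤ q))
        + linRank st.linear q) - rank zs q - x)
    have h3 := le_abs_self (2 ^ P.levels * ((batch.countP fun x => decide (x ≤ q) : ℕ) : ℝ)
      + (∑ h ∈ Finset.Ico P.samplerLevels P.levels,
        (2 : ℝ) ^ h * ((st.buffer h).countP fun x => decide (x ≤ q))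
        + linRank st.linear q) - rank zs q - x)
    constructor <;> linarith [herr.1, herr.2, herr'.1, herr'.2, k6.1, k6.2]

/-- Changing one buffer changes one term of a sum over the buffers. -/
lemma sum_update_buffer {M : Type*} [AddCommMonoid M] (φ : ℕ → List ℝ → M) (s : Finset ℕ)
    (buf : ℕ → List ℝ) {h : ℕ} (hh : h ∈ s) (b : List ℝ) :
    ∑ i ∈ s, φ i (Function.update buf h b i) = φ h b + ∑ i ∈ s.erase h, φ i (buf i) := by
  rw [← Finset.add_sum_erase s _ hh, Function.update_self]
  congr 1
  refine Finset.sum_congr rfl fun i hi => ?_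
  rw [Function.update_of_ne (Finset.ne_of_mem_erase hi)]

/-- A compactor that does not fill up stores the batch. -/
lemma inv_store {q : ℝ} {zs : List ℝ} {N : ℕ} {m : ℕ → ℕ} {h : ℕ} (hlt : P.samplerLevels < P.levels)
    (h1 : P.samplerLevels ≤ h) (h2 : h < P.levels) {batch : List ℝ} {st : State} {x : ℝ}
    (I : Inv P D q zs N m h batch st x) (hb : (st.buffer h ++ batch).length < P.cap h) :
    Inv P D q zs N m P.samplerLevels []
      { st with buffer := Function.update st.buffer h (st.buffer h ++ batch) } x := by
  have hmem : h ∈ Finset.Ico P.samplerLevels P.levels := Finset.mem_Ico.2 ⟨h1, h2⟩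
  refine ⟨?_, ?_, ?_, I.proper, I.jump, ?_, I.length_le, ?_⟩
  · intro i hi1 hi2
    have := I.flow i hi1 hi2
    by_cases hi : i = h
    · subst hi
      simpa [add_assoc] using this
    · simpa [hi] using this
  · intro i hi1 hi2
    by_cases hi : i = h
    · subst hi
      simpa using hb
    · simpa [hi] using I.short i hi1 hi2
  · refine le_trans (le_of_eq ?_) I.items
    simp only
    rw [sum_update_buffer (fun _ l => (l : Multiset ℝ)) _ _ hmem, ← Finset.add_sum_erase _ _ hmem,
      ← Multiset.coe_add, Multiset.coe_nil]
    abel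
  · have := I.weight
    rw [if_neg h2.ne] at this
    rw [if_neg hlt.ne]
    exact this
  · have := I.err
    rw [if_neg h2.ne] at this
    rw [if_neg hlt.ne]
    refine le_trans (le_of_eq ?_) this
    simp only [stored, List.countP_nil, Nat.cast_zero, mul_zero, zero_add]
    rw [sum_update_buffer (fun i l => (2 : ℝ) ^ i * (l.countP fun x => decide (x ≤ q))) _ _ hmem,
      ← Finset.add_sum_erase _ _ hmem, List.countP_append]
    push_cast
    congr 2
    ring

/-- A full compactor is compacted: the error changes by `2 ^ h` times the change `σ` of the rank
that is caused by doubling the weights of the selected items. -/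
lemma inv_compact (hP : P.Admissible n D) {q : ℝ} {zs : List ℝ} {N : ℕ} {m : ℕ → ℕ} {h : ℕ}
    (h1 : P.samplerLevels ≤ h) (h2 : h < P.levels) {batch : List ℝ} {st : State} {x : ℝ}
    (I : Inv P D q zs N m h batch st x) (hb : ¬ (st.buffer h ++ batch).length < P.cap h)
    (hbatch : batch.length ≤ P.cap h) (i : Bool) (x' : ℝ)
    (hx' : |x + 2 ^ h * (2 * ((alternate i (((st.buffer h ++ batch).take
        (P.cap h)).insertionSort (· ≤ ·))).countP fun x => decide (x ≤ q))
      - (((st.buffer h ++ batch).take (P.cap h)).countP fun x => decide (x ≤ q))) - x'|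
        ≤ if h + P.s < P.H then 0 else 2 ^ h) :
    Inv P D q zs N (Function.update m h (m h + 1)) (h + 1)
      (alternate i (((st.buffer h ++ batch).take (P.cap h)).insertionSort (· ≤ ·)))
      { st with buffer := Function.update st.buffer h ((st.buffer h ++ batch).drop (P.cap h)) }
      x' := by
  have hmem : h ∈ Finset.Ico P.samplerLevels P.levels := Finset.mem_Ico.2 ⟨h1, h2⟩
  set b := st.buffer h ++ batch with hbdef
  set c := P.cap h with hc
  have htake : (b.take c).length = c := by rw [List.length_take]; omega
  have heven := hP.even h
  rw [← hc] at heven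
  have halt : (alternate i ((b.take c).insertionSort (· ≤ ·))).length = c / 2 := by
    rw [length_alternate, List.length_insertionSort, htake]
    split_ifs <;> omega
  set out := alternate i ((b.take c).insertionSort (· ≤ ·)) with hout
  have hlenb : b.length = (st.buffer h).length + batch.length := by rw [hbdef, List.length_append]
  have hflow := I.flow h h1 h2
  rw [if_pos rfl, ← hlenb, ← hc] at hflow
  have hcount : (b.countP fun x => decide (x ≤ q))
      = ((b.take c).countP fun x => decide (x ≤ q)) + ((b.drop c).countP fun x => decide (x ≤ q)) := by
    rw [← List.countP_append, List.take_append_drop]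
  have hcountb : (b.countP fun x => decide (x ≤ q))
      = ((st.buffer h).countP fun x => decide (x ≤ q)) + (batch.countP fun x => decide (x ≤ q)) := by
    rw [hbdef, List.countP_append]
  refine ⟨?_, ?_, ?_, I.proper, I.jump, ?_, I.length_le, ?_⟩
  · intro j hj1 hj2
    have hj := I.flow j hj1 hj2
    by_cases hjh : j = h
    · subst hjh
      have hin : inflow P N (Function.update m j (m j + 1)) j = inflow P N m j := by
        unfold inflow
        split_ifs with hs
        · rfl
        · rw [Function.update_of_ne (by omega)]
      rw [hin, if_neg (by omega)]
      simp only [Function.update_self, List.length_drop]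
      rw [← hc, mul_add, mul_one]
      omega
    · by_cases hjh' : j = h + 1
      · subst hjh'
        rw [if_neg hjh, inflow, if_neg (by omega), Nat.add_sub_cancel] at hj
        rw [if_pos rfl, inflow, if_neg (by omega), Nat.add_sub_cancel]
        simp only [Function.update_self, Function.update_of_ne hjh]
        rw [mul_add, mul_one, ← hj, halt]
        ring
      · have hin : inflow P N (Function.update m h (m h + 1)) j = inflow P N m j := by
          unfold inflow
          split_ifs with hs
          · rfl
          · rw [Function.update_of_ne (by omega)]
        rw [if_neg hjh] at hj
        rw [hin, if_neg hjh']
        simpa only [Function.update_of_ne hjh] using hj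
  · intro j hj1 hj2
    by_cases hjh : j = h
    · subst hjh
      have := I.short j hj1 hj2
      simp only [Function.update_self, List.length_drop]
      omega
    · simpa only [Function.update_of_ne hjh] using I.short j hj1 hj2
  · refine le_trans ?_ I.items
    simp only
    rw [sum_update_buffer (fun _ l => (l : Multiset ℝ)) _ _ hmem,
      ← Finset.add_sum_erase (Finset.Ico P.samplerLevels P.levels)
        (fun h => (st.buffer h : Multiset ℝ)) hmem]
    have e1 : (out : Multiset ℝ) ≤ (b.take c : Multiset ℝ) :=
      (alternate_sublist i _).subperm.trans (List.perm_insertionSort _ _).subperm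
    have e2 : ((b.take c : Multiset ℝ) + (b.drop c : Multiset ℝ))
        = (st.buffer h : Multiset ℝ) + (batch : Multiset ℝ) := by
      rw [Multiset.coe_add, Multiset.coe_add, List.take_append_drop]
    have e3 : (out : Multiset ℝ) + (b.drop c : Multiset ℝ)
        ≤ (batch : Multiset ℝ) + (st.buffer h : Multiset ℝ) := by
      rw [add_comm (batch : Multiset ℝ), ← e2]
      exact add_le_add_left e1 _
    rw [← add_assoc, ← add_assoc]
    exact add_le_add_left (add_le_add_left e3 _) _
  · have hw := I.weight
    rw [if_neg h2.ne] at hw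
    by_cases htop : h + 1 = P.levels
    · have hh : P.levels - 1 = h := by omega
      have hck : c = P.k := by rw [hc, ← hh, hP.cap_top]
      rw [if_pos htop, hh, Function.update_self, halt, hck]
      rw [hh] at hw
      simp only at hw ⊢
      push_cast at hw ⊢
      linarith
    · rw [if_neg htop, Function.update_of_ne (by omega)]
      exact hw
  · have he := I.err
    rw [if_neg h2.ne, add_zero] at he
    have hst : (2 : ℝ) ^ (h + 1) * (out.countP fun x => decide (x ≤ q))
          + stored P { st with buffer := Function.update st.buffer h (b.drop c) } q
        = 2 ^ h * (batch.countP fun x => decide (x ≤ q)) + stored P st q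
          + 2 ^ h * (2 * (out.countP fun x => decide (x ≤ q))
            - ((b.take c).countP fun x => decide (x ≤ q))) := by
      simp only [stored]
      rw [sum_update_buffer (fun i l => (2 : ℝ) ^ i * (l.countP fun x => decide (x ≤ q))) _ _ hmem,
        ← Finset.add_sum_erase (Finset.Ico P.samplerLevels P.levels)
          (fun h => (2 : ℝ) ^ h * ((st.buffer h).countP fun x => decide (x ≤ q))) hmem]
      have e : ((b.take c).countP (fun x => decide (x ≤ q)) : ℝ)
            + ((b.drop c).countP fun x => decide (x ≤ q))
          = ((st.buffer h).countP fun x => decide (x ≤ q))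
            + (batch.countP fun x => decide (x ≤ q)) := by
        exact_mod_cast hcount.symm.trans hcountb
      have e' := congrArg (fun z : ℝ => 2 ^ h * z) e
      simp only [mul_add] at e'
      rw [pow_succ]
      linarith
    have hdrift : drift P D m + (if h + P.s < P.H then 0 else 2 ^ h)
          + (if h + 1 = P.levels then 3 * D else 0)
        = drift P D (Function.update m h (m h + 1)) := by
      unfold drift
      rw [← Finset.add_sum_erase _ _ hmem,
        ← Finset.add_sum_erase (Finset.Ico P.samplerLevels P.levels) (fun i =>
          if i + P.s < P.H then (0 : ℝ) else 2 ^ i * (Function.update m h (m h + 1) i : ℕ)) hmem]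
      have e1 : ∑ j ∈ (Finset.Ico P.samplerLevels P.levels).erase h,
            (if j + P.s < P.H then (0 : ℝ) else 2 ^ j * (Function.update m h (m h + 1) j : ℕ))
          = ∑ j ∈ (Finset.Ico P.samplerLevels P.levels).erase h,
            if j + P.s < P.H then (0 : ℝ) else 2 ^ j * (m j : ℕ) :=
        Finset.sum_congr rfl fun j hj => by
          rw [Function.update_of_ne (Finset.ne_of_mem_erase hj)]
      rw [e1, Function.update_self]
      by_cases htop : h + 1 = P.levels
      · have hh : P.levels - 1 = h := by omega
        rw [if_pos htop, hh, Function.update_self]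
        push_cast
        split_ifs <;> ring
      · rw [if_neg htop, Function.update_of_ne (show P.levels - 1 ≠ h by omega)]
        push_cast
        split_ifs <;> ring
    rw [← hdrift, hst]
    refine add_le_add_left (le_trans ?_ (add_le_add he hx')) _
    refine le_trans (le_of_eq ?_) (abs_add_le _ _)
    congr 1
    ring

lemma variance_update {h : ℕ} (h1 : P.samplerLevels ≤ h) (h2 : h < P.levels) (N : ℕ) (m : ℕ → ℕ) :
    variance P N (Function.update m h (m h + 1))
      = variance P N m + if h + P.s < P.H then ((2 : ℝ) ^ h) ^ 2 else 0 := by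
  have hmem : h ∈ Finset.Ico P.samplerLevels P.levels := Finset.mem_Ico.2 ⟨h1, h2⟩
  unfold variance
  rw [← Finset.add_sum_erase _ _ hmem,
    ← Finset.add_sum_erase (Finset.Ico P.samplerLevels P.levels) (fun i =>
      if i + P.s < P.H then (m i : ℝ) * ((2 : ℝ) ^ i) ^ 2 else 0) hmem]
  have e1 : ∑ j ∈ (Finset.Ico P.samplerLevels P.levels).erase h,
        (if j + P.s < P.H then ((Function.update m h (m h + 1) j : ℕ) : ℝ) * ((2 : ℝ) ^ j) ^ 2 else 0)
      = ∑ j ∈ (Finset.Ico P.samplerLevels P.levels).erase h,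
        if j + P.s < P.H then (m j : ℝ) * ((2 : ℝ) ^ j) ^ 2 else 0 :=
    Finset.sum_congr rfl fun j hj => by
      rw [Function.update_of_ne (Finset.ne_of_mem_erase hj)]
  rw [e1, Function.update_self]
  push_cast
  split_ifs <;> ring

/-- Feeding a batch preserves the invariant; the random errors below the top `s` heights are
recorded in the error and in the variance, the other errors are covered by the drift. -/
lemma reaches_feed (lam : ℝ) (hP : P.Admissible n D) {q : ℝ} {zs : List ℝ} (hzs : zs.Nodup) {N : ℕ}
    (hN : N * 2 ^ P.samplerLevels ≤ n) (r : ℕ) (hr : r ≤ P.levels - P.samplerLevels)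
    (hr0 : r = 0 → 0 < P.replaced) (batch : List ℝ) (st : State) (m : ℕ → ℕ) (x : ℝ)
    (hb : batch.length ≤ P.cap (P.levels - r)) (I : Inv P D q zs N m (P.levels - r) batch st x) :
    Reaches lam (feed P r batch st) (fun st' x' v' => st'.count = st.count ∧
      ∃ m', Inv P D q zs N m' P.samplerLevels [] st' x' ∧ v' = variance P N m') x
      (variance P N m) := by
  have hlt := hP.lt
  induction r generalizing batch st m x with
  | zero =>
    rw [feed]
    rw [Nat.sub_zero] at I hb
    exact Reaches.pure ⟨rfl, m, inv_receive hP (hr0 rfl) hzs hN I (hb.trans (hP.cap_le _)), rfl⟩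
  | succ r ih =>
    rw [feed]
    set h := P.levels - (r + 1) with hh
    have h1 : P.samplerLevels ≤ h := by omega
    have h2 : h < P.levels := by omega
    have hsucc : P.levels - r = h + 1 := by omega
    rw [hsucc] at ih
    split_ifs with hfull
    · exact Reaches.pure ⟨rfl, m, inv_store hlt h1 h2 I hfull, rfl⟩
    · set b := st.buffer h ++ batch with hbdef
      set ρ : ℕ := ((b.take (P.cap h)).countP fun x => decide (x ≤ q)) % 2 with hρ
      have hρ1 : (ρ : ℝ) ≤ 1 := by
        have : ρ ≤ 1 := by omega
        exact_mod_cast this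
      have hρ0 : (0 : ℝ) ≤ ρ := by positivity
      have h2h : (0 : ℝ) < 2 ^ h := by positivity
      have hr0' : r = 0 → 0 < P.replaced := by
        rintro rfl
        by_contra hrep
        have htop := hP.top (by omega)
        rw [show P.levels - 1 = h by omega] at htop
        have h3 := I.flow h h1 h2
        have h4 := inflow_le hP hN I.cap_mul_le h1 h2
        rw [if_pos rfl, ← List.length_append, ← hbdef] at h3
        omega
      have hlen : ∀ i, (alternate i ((b.take (P.cap h)).insertionSort (· ≤ ·))).length
          ≤ P.cap (h + 1) := by
        intro i
        refine ((alternate_sublist i _).length_le.trans ?_).trans (hP.cap_mono h)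
        rw [List.length_insertionSort, List.length_take]
        exact min_le_left _ _
      have hσ := fun i => two_mul_countP_alternate_sub q i (b.take (P.cap h))
      by_cases hlow : h + P.s < P.H
      · refine Reaches.coin (b := 2 ^ h * ρ) fun i => ?_
        have I' := inv_compact hP h1 h2 I hfull hb i
          (x + if i then (2 : ℝ) ^ h * ρ else -(2 ^ h * ρ)) (by
            rw [if_pos hlow, hσ i]
            cases i <;> simp [hρ])
        have := ih (by omega) hr0' _ _ _ _ (hlen i) I'
        refine this.of_le ?_
        rw [variance_update h1 h2, if_pos hlow]
        have : (2 ^ h * (ρ : ℝ)) ^ 2 ≤ (2 ^ h) ^ 2 := by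
          refine pow_le_pow_left₀ (by positivity) ?_ 2
          nlinarith
        linarith
      · refine Reaches.bind_of_forall fun i => ?_
        have I' := inv_compact hP h1 h2 I hfull hb i x (by
            rw [if_neg hlow, hσ i, add_sub_cancel_left, abs_mul, abs_of_pos h2h]
            have : |(if i then (ρ : ℝ) else -ρ)| ≤ 1 := by
              cases i <;> simp [abs_of_nonneg hρ0, hρ1]
            nlinarith)
        have := ih (by omega) hr0' _ _ _ _ (hlen i) I'
        rw [variance_update h1 h2, if_neg hlow, add_zero] at this
        exact this

end

/-! ### The run on a stream -/

lemma runFrom_append (P : Params) (st : State) (xs ys : List ℝ) :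
    runFrom P st (xs ++ ys) = (runFrom P st xs).bind fun st' => runFrom P st' ys := by
  induction xs generalizing st with
  | nil => simp [runFrom]
  | cons x xs ih => simp [runFrom, ih]

section
variable {P : Params} {n : ℕ} {D : ℝ}

lemma inv_init (hP : P.Admissible n D) (q : ℝ) :
    Inv P D q [] 0 (fun _ => 0) P.samplerLevels [] State.init 0 := by
  have hlt := hP.lt
  refine ⟨?_, ?_, ?_, ⟨?_, ?_⟩, ?_, ?_, ?_, ?_⟩
  · intro h _ _
    simp [State.init, inflow]
  · intro h _ _
    have := hP.two_le h
    simp only [State.init, List.length_nil]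
    omega
  · simp [State.init]
  · simp [State.init]
  · simp [State.init]
  · intro b _
    simpa [State.init, linRank] using hP.pos.le
  · simp [State.init, hlt.ne]
  · simp [State.init]
  · simp [State.init, hlt.ne, stored, drift, rank, linRank]

/-- The sampler passes on an item `y` of the block `us`, with the weight of the block. -/
lemma inv_sample (hlt : P.samplerLevels < P.levels) {q : ℝ} {zs us : List ℝ} {N : ℕ} {m : ℕ → ℕ}
    {st : State} {x : ℝ} (I : Inv P D q zs N m P.samplerLevels [] st x) {y : ℝ} (hy : y ∈ us)
    (z : ℝ) :
    Inv P D q (zs ++ us) (N + 1) m P.samplerLevels [y] { st with count := 0, sample := z }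
      (x + (2 ^ P.samplerLevels * (if y ≤ q then 1 else 0) - rank us q)) := by
  refine ⟨?_, I.short, ?_, I.proper, I.jump, ?_, I.length_le, ?_⟩
  · intro h h1 h2
    have := I.flow h h1 h2
    by_cases hh : h = P.samplerLevels
    · simp only [inflow, if_pos hh, List.length_nil, List.length_singleton] at this ⊢
      omega
    · simpa only [inflow, if_neg hh] using this
  · have h1 := I.items
    rw [Multiset.coe_nil, zero_add] at h1
    have h2 : ([y] : Multiset ℝ) ≤ (us : Multiset ℝ) := by simpa using hy
    rw [add_assoc, ← Multiset.coe_add, add_comm (zs : Multiset ℝ)]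
    exact add_le_add h2 h1
  · have := I.weight
    rw [if_neg hlt.ne] at this ⊢
    exact this
  · have := I.err
    rw [if_neg hlt.ne] at this ⊢
    refine le_trans (le_of_eq ?_) this
    have e : (([y].countP fun x => decide (x ≤ q) : ℕ) : ℝ) = if y ≤ q then 1 else 0 := by
      simp [List.countP_cons]
    rw [e, rank_append]
    simp only [stored, List.countP_nil]
    push_cast
    congr 2
    ring

/-- The relation between the memory after the stream `ws` and the accumulated error and variance:
the invariant holds for the completed blocks `zs`, and `us` is the unfinished block. -/
def AfterStream (P : Params) (D q : ℝ) (ws : List ℝ) (st : State) (x v : ℝ) : Prop :=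
  ∃ (zs us : List ℝ) (N : ℕ) (m : ℕ → ℕ), ws = zs ++ us ∧ zs.length = N * 2 ^ P.samplerLevels ∧
    Inv P D q zs N m P.samplerLevels [] st x ∧ st.count = us.length ∧
    us.length < 2 ^ P.samplerLevels ∧ v = variance P N m

/-- An unfinished block changes only the sampler. -/
lemma reaches_unfinished (lam : ℝ) (us : List ℝ) (st : State)
    (hlen : st.count + us.length < 2 ^ P.samplerLevels) (x v : ℝ) :
    Reaches lam (runFrom P st us) (fun st' x' v' => x' = x ∧ v' = v ∧
      st'.count = st.count + us.length ∧ st'.buffer = st.buffer ∧ st'.linear = st.linear) x v := by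
  induction us generalizing st with
  | nil =>
    rw [runFrom]
    exact Reaches.pure ⟨rfl, rfl, rfl, rfl, rfl⟩
  | cons u us ih =>
    rw [List.length_cons] at hlen
    rw [runFrom, step, PMF.bind_bind]
    refine Reaches.bind_of_forall fun j => ?_
    simp only
    rw [if_pos (by omega), PMF.pure_bind]
    refine (ih { st with count := st.count + 1, sample := if j = 0 then u else st.sample }
      (by simp only; omega)).mono ?_
    rintro a x' v' ⟨h1, h2, h3, h4, h5⟩
    refine ⟨h1, h2, ?_, h4, h5⟩
    rw [h3, List.length_cons]
    simp only
    omega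

lemma Inv.congr {q : ℝ} {zs : List ℝ} {N : ℕ} {m : ℕ → ℕ} {h₀ : ℕ} {batch : List ℝ}
    {st st' : State} {x : ℝ} (I : Inv P D q zs N m h₀ batch st x) (hb : st'.buffer = st.buffer)
    (hl : st'.linear = st.linear) : Inv P D q zs N m h₀ batch st' x := by
  obtain ⟨c, z, b, l⟩ := st
  obtain ⟨c', z', b', l'⟩ := st'
  simp only at hb hl
  subst hb hl
  exact ⟨I.flow, I.short, I.items, I.proper, I.jump, I.weight, I.length_le, I.err⟩

lemma reaches_runFrom (lam : ℝ) (hP : P.Admissible n D) (q : ℝ) (ys zs : List ℝ) (N : ℕ)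
    (m : ℕ → ℕ) (st : State) (x : ℝ) (I : Inv P D q zs N m P.samplerLevels [] st x)
    (hst : st.count = 0) (hzs : zs.length = N * 2 ^ P.samplerLevels) (hnd : (zs ++ ys).Nodup)
    (hn : (zs ++ ys).length ≤ n) :
    Reaches lam (runFrom P st ys) (AfterStream P D q (zs ++ ys)) x (variance P N m) := by
  have hlt := hP.lt
  have hpos : 0 < 2 ^ P.samplerLevels := by positivity
  induction hl : ys.length using Nat.strong_induction_on generalizing ys zs N m st x with
  | _ l ih =>
    rcases lt_or_ge ys.length (2 ^ P.samplerLevels) with hys | hys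
    · refine (reaches_unfinished lam ys st (by omega) x _).mono ?_
      rintro st' x' v' ⟨rfl, rfl, h3, h4, h5⟩
      exact ⟨zs, ys, N, m, rfl, hzs, I.congr h4 h5, by omega, hys, rfl⟩
    · obtain ⟨us, vs, rfl, hus⟩ : ∃ us vs, ys = us ++ vs ∧ us.length = 2 ^ P.samplerLevels :=
        ⟨ys.take (2 ^ P.samplerLevels), ys.drop (2 ^ P.samplerLevels),
          (List.take_append_drop _ _).symm, List.length_take_of_le hys⟩
      rw [← List.append_assoc] at hnd hn ⊢
      have hzs' : (zs ++ us).length = (N + 1) * 2 ^ P.samplerLevels := by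
        rw [List.length_append, hzs, hus]; ring
      have hN : (N + 1) * 2 ^ P.samplerLevels ≤ n := by
        rw [List.length_append] at hn; omega
      rw [runFrom_append]
      refine Reaches.bind (R := fun st' x' v' => st'.count = 0 ∧
        ∃ m', Inv P D q (zs ++ us) (N + 1) m' P.samplerLevels [] st' x'
          ∧ v' = variance P (N + 1) m') ?_ ?_
      · refine reaches_block hus hst q fun y hy z => ?_
        have hsub : P.levels - (P.levels - P.samplerLevels) = P.samplerLevels := by omega
        have hcap := hP.two_le P.samplerLevels
        have := reaches_feed lam hP (List.nodup_append.1 hnd).1 hN (P.levels - P.samplerLevels)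
          le_rfl (fun h => by omega) [y] { st with count := 0, sample := z } m
          (x + (2 ^ P.samplerLevels * (if y ≤ q then 1 else 0) - rank us q))
          (by rw [hsub, List.length_singleton]; omega)
          (by rw [hsub]; exact inv_sample hlt I hy z)
        convert this using 1
        unfold variance
        push_cast
        ring
      · rintro st' x' v' ⟨h1, m', I', rfl⟩
        exact ih vs.length (by rw [← hl, List.length_append]; omega) vs (zs ++ us) (N + 1) m' st' x'
          I' h1 hzs' hnd hn rfl

/-- The run on a stream keeps the relation between memory, error and variance. -/
lemma reaches_run (lam : ℝ) (hP : P.Admissible n D) (q : ℝ) {ws : List ℝ} (hnd : ws.Nodup)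
    (hn : ws.length ≤ n) : Reaches lam (run P ws) (AfterStream P D q ws) 0 0 := by
  have := reaches_runFrom lam hP q ws [] 0 (fun _ => 0) State.init 0 (inv_init hP q) rfl (by simp)
    hnd hn
  rw [run]
  simpa [variance] using this

/-- The item in the sampler stands for the unfinished block, with an error of less than the block
length. -/
lemma AfterStream.abs_estimate_sub_le {q : ℝ} {ws : List ℝ} {st : State} {x v : ℝ}
    (hlt : P.samplerLevels < P.levels) (h : AfterStream P D q ws st x v) :
    ∃ N m, N * 2 ^ P.samplerLevels ≤ ws.length ∧
      (∀ h, P.samplerLevels ≤ h → h < P.levels → P.cap h * m h ≤ inflow P N m h) ∧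
      v = variance P N m ∧
      |estimate P st q - rank ws q - x| ≤ 2 ^ P.samplerLevels - 1 + drift P D m := by
  obtain ⟨zs, us, N, m, rfl, h1, I, h2, h3, h4⟩ := h
  refine ⟨N, m, by rw [List.length_append]; omega, I.cap_mul_le, h4, ?_⟩
  have h5 := I.err
  rw [if_neg hlt.ne, add_zero, List.countP_nil] at h5
  have h6 : |(if st.sample ≤ q then (st.count : ℝ) else 0) - rank us q| ≤ 2 ^ P.samplerLevels - 1 := by
    have h7 : (us.length : ℝ) + 1 ≤ 2 ^ P.samplerLevels := by exact_mod_cast h3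
    have h8 : (rank us q : ℝ) ≤ us.length := by
      have : rank us q ≤ us.length := List.countP_le_length
      exact_mod_cast this
    have h9 : (0 : ℝ) ≤ rank us q := by positivity
    rw [h2]
    split_ifs <;> rw [abs_le] <;> constructor <;> linarith
  refine le_trans ?_ (add_le_add h6 h5)
  refine le_trans (le_of_eq ?_) (abs_add_le _ _)
  rw [rank_append, estimate, stored]
  push_cast
  congr 1
  ring

lemma AfterStream.space_le {q : ℝ} {ws : List ℝ} {st : State} {x v : ℝ}
    (h : AfterStream P D q ws st x v) :
    space P st ≤ 2 + ∑ h ∈ Finset.Ico P.samplerLevels P.levels, P.cap h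
      + 2 * (P.replaced * P.k) := by
  obtain ⟨zs, us, N, m, rfl, h1, I, h2, h3, h4⟩ := h
  have h5 : ∑ h ∈ Finset.Ico P.samplerLevels P.levels, (1 + (st.buffer h).length)
      ≤ ∑ h ∈ Finset.Ico P.samplerLevels P.levels, P.cap h :=
    Finset.sum_le_sum fun h hh => by
      obtain ⟨hh1, hh2⟩ := Finset.mem_Ico.1 hh
      have := I.short h hh1 hh2
      omega
  have h6 := I.length_le
  unfold space
  omega

end

/-! ### Bounds for the parameters of the sketch -/

/-- The relations between the parameters of a sketch for streams of length `n` that are used in the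
bounds on drift, variance and space. -/
structure Params.Standard (P : Params) (n : ℕ) : Prop where
  rule : IsOptimalRule P.compact
  half_lt : 1 / 2 < P.c
  lt_one : P.c < 1
  even : 2 * (P.k / 2) = P.k
  four_le : 4 ≤ P.k
  lt_s : P.t < P.s
  height : P.H = kllHeight P.k P.s P.c n

section
variable {P : Params} {n : ℕ}

lemma Params.replaced_le (P : Params) : P.replaced ≤ P.t := min_le_left _ _

lemma Params.replaced_le_height (P : Params) : P.replaced ≤ P.H - 1 := min_le_right _ _

lemma sum_pow_sub_mul (r : ℝ) (M : ℕ) :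
    (∑ h ∈ Finset.range M, r ^ (M - h)) * (1 - r) = r - r ^ (M + 1) := by
  induction M with
  | zero => simp
  | succ M ih =>
    rw [Finset.sum_range_succ']
    simp only [Nat.add_sub_add_right, Nat.sub_zero]
    rw [add_mul, ih]
    ring

lemma sum_pow_sub_le {r : ℝ} (h0 : 0 ≤ r) (h1 : r < 1) (M : ℕ) :
    ∑ h ∈ Finset.range M, r ^ (M - h) ≤ r / (1 - r) := by
  rw [le_div_iff₀ (by linarith), sum_pow_sub_mul]
  have := pow_nonneg h0 (M + 1)
  linarith

/-- Below the top `s` heights, the sum of `r ^ (H - h)` is a geometric series. -/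
lemma sum_ite_pow_le (P : Params) {r b : ℝ} (h0 : 0 ≤ r) (h1 : r < 1) (hb : 0 ≤ b) :
    ∑ h ∈ Finset.Ico P.samplerLevels P.levels, (if h + P.s < P.H then b * r ^ (P.H - h) else 0)
      ≤ b * (r ^ P.s * (r / (1 - r))) := by
  rw [← Finset.sum_filter]
  calc ∑ h ∈ (Finset.Ico P.samplerLevels P.levels).filter fun h => h + P.s < P.H,
        b * r ^ (P.H - h)
      ≤ ∑ h ∈ Finset.range (P.H - P.s), b * r ^ (P.H - h) :=
        Finset.sum_le_sum_of_subset_of_nonneg (fun h hh => by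
          have := (Finset.mem_filter.1 hh).2
          rw [Finset.mem_range]
          omega) fun _ _ _ => by positivity
    _ = b * (r ^ P.s * ∑ h ∈ Finset.range (P.H - P.s), r ^ (P.H - P.s - h)) := by
        rw [Finset.mul_sum, Finset.mul_sum]
        refine Finset.sum_congr rfl fun h hh => ?_
        rw [Finset.mem_range] at hh
        rw [← pow_add, show P.H - h = P.s + (P.H - P.s - h) by omega]
    _ ≤ _ := by
        have := sum_pow_sub_le h0 h1 (P.H - P.s)
        gcongr

namespace Params.Standard

lemma c_pos (hP : P.Standard n) : 0 < P.c := by linarith [hP.half_lt]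

lemma k_pos (hP : P.Standard n) : (0 : ℝ) < P.k := by
  have := hP.four_le
  exact_mod_cast (by omega : 0 < P.k)

lemma one_le_height (hP : P.Standard n) : 1 ≤ P.H := by
  rw [hP.height]
  exact (kllHeight_spec hP.even (by linarith [hP.four_le])).1

lemma samplerLevels_le (hP : P.Standard n) : P.samplerLevels ≤ P.H - P.s := by
  refine Nat.sInf_le ?_
  have h4 := hP.four_le
  simp only [Set.mem_ofPred_eq, Params.cap]
  rw [capacity_of_le (by omega)]
  omega

lemma samplerLevels_lt (hP : P.Standard n) : P.samplerLevels < P.levels := by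
  have h1 := hP.samplerLevels_le
  have h2 := hP.one_le_height
  have h3 := hP.lt_s
  have h4 := P.replaced_le
  have h5 := P.replaced_le_height
  unfold Params.levels
  omega

lemma two_pow_height_mul_le (hP : P.Standard n) (hH : 1 < P.H) :
    (2 : ℝ) ^ P.H * P.k ≤ 4 * n := by
  have h := hP.height
  have := two_pow_kllHeight_mul_le (n := n) (c := P.c) (s := P.s) hP.even
    (by have := hP.lt_s; omega) (by omega)
  rw [← h] at this
  exact_mod_cast this

lemma admissible (hP : P.Standard n) {D : ℝ} (hD : 0 < D) (hDn : 8 * (n : ℝ) ≤ D * P.k) :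
    P.Admissible n D where
  rule := hP.rule
  lt := hP.samplerLevels_lt
  even := two_mul_capacity_div_two hP.even
  two_le := two_le_capacity (by linarith [hP.four_le])
  cap_le := capacity_le hP.c_pos hP.lt_one hP.even (by linarith [hP.four_le])
  cap_mono := capacity_mono hP.c_pos hP.lt_one hP.even (by linarith [hP.four_le])
  cap_top := capacity_of_le (by
    have h1 := hP.lt_s
    have h2 := P.replaced_le
    unfold Params.levels
    omega)
  four_le := hP.four_le
  top := by
    intro h
    have := (kllHeight_spec (s := P.s) (c := P.c) (n := n) hP.even (by linarith [hP.four_le])).2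
    rw [← hP.height] at this
    simpa [Params.levels, h, Params.cap] using this
  weight_le := by
    intro h
    have h1 := P.replaced_le_height
    have h2 := hP.two_pow_height_mul_le (by omega)
    have h3 : (2 : ℝ) ^ P.levels ≤ 2 ^ P.H :=
      pow_le_pow_right₀ one_le_two (by unfold Params.levels; omega)
    have h4 : (0 : ℝ) ≤ n := by positivity
    have h5 := hP.k_pos
    refine le_of_mul_le_mul_right ?_ h5
    nlinarith
  pos := hD
  loss_le := hDn

/-- The length of a block of the sampler. -/
lemma two_pow_samplerLevels_sub_one_le (hP : P.Standard n) :
    (2 : ℝ) ^ P.samplerLevels - 1 ≤ 4 * (n / P.k) := by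
  have hk := hP.k_pos
  rcases Nat.eq_zero_or_pos P.samplerLevels with h | h
  · rw [h, pow_zero, sub_self]; positivity
  · have h1 := hP.samplerLevels_le
    have h2 := hP.lt_s
    have h3 := hP.two_pow_height_mul_le (by omega)
    have h4 : (2 : ℝ) ^ P.samplerLevels ≤ 2 ^ P.H := pow_le_pow_right₀ one_le_two (by omega)
    have h5 : (2 : ℝ) ^ P.H ≤ 4 * (n / P.k) := by
      rw [← mul_div_assoc, le_div_iff₀ hk]; exact h3
    linarith

lemma two_pow_mul_le_div_cap (hP : P.Standard n) {N : ℕ} (hN : N * 2 ^ P.samplerLevels ≤ n)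
    {m : ℕ → ℕ}
    (hm : ∀ h, P.samplerLevels ≤ h → h < P.levels → P.cap h * m h ≤ inflow P N m h) {h : ℕ}
    (h1 : P.samplerLevels ≤ h) (h2 : h < P.levels) : (2 : ℝ) ^ h * m h ≤ n / P.cap h := by
  have hA := hP.admissible (D := 8 * (n + 1) / P.k)
    (div_pos (by positivity) hP.k_pos) (by rw [div_mul_cancel₀ _ hP.k_pos.ne']; linarith)
  have h3 := two_pow_mul_cap_mul_le hA hN hm h1 h2
  have h4 : (0 : ℝ) < P.cap h := by
    have := hA.two_le h
    exact_mod_cast (by omega : 0 < P.cap h)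
  rw [le_div_iff₀ h4]
  have h3' : (2 : ℝ) ^ h * (P.cap h * m h) ≤ n := by exact_mod_cast h3
  linarith

/-- There are at most `2 ^ (t + 1)` batches for the linear compactor. -/
lemma batches_le (hP : P.Standard n) {N : ℕ} (hN : N * 2 ^ P.samplerLevels ≤ n) {m : ℕ → ℕ}
    (hm : ∀ h, P.samplerLevels ≤ h → h < P.levels → P.cap h * m h ≤ inflow P N m h) :
    m (P.levels - 1) ≤ 2 ^ (P.t + 1) := by
  have hA := hP.admissible (D := 8 * (n + 1) / P.k)
    (div_pos (by positivity) hP.k_pos) (by rw [div_mul_cancel₀ _ hP.k_pos.ne']; linarith)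
  have hlt := hP.samplerLevels_lt
  have h1 := two_pow_mul_cap_mul_le hA hN hm (h := P.levels - 1) (by omega) (by omega)
  rw [hA.cap_top] at h1
  have h2 := le_mul_two_pow_kllHeight (s := P.s) (n := n) hP.c_pos hP.lt_one hP.even
    (by linarith [hP.four_le])
  rw [← hP.height] at h2
  have h3 : P.H = (P.levels - 1) + (P.replaced + 1) := by
    have := P.replaced_le_height
    have := hP.one_le_height
    unfold Params.levels
    omega
  have h4 : 2 ^ (P.levels - 1) * P.k * m (P.levels - 1)
      ≤ 2 ^ (P.levels - 1) * P.k * 2 ^ (P.replaced + 1) := by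
    rw [h3, pow_add] at h2
    calc 2 ^ (P.levels - 1) * P.k * m (P.levels - 1)
        = 2 ^ (P.levels - 1) * (P.k * m (P.levels - 1)) := by ring
      _ ≤ n := h1
      _ ≤ _ := h2
      _ = _ := by ring
  have h5 : 0 < 2 ^ (P.levels - 1) * P.k := by
    have := hP.four_le
    positivity
  exact (Nat.le_of_mul_le_mul_left h4 h5).trans
    (Nat.pow_le_pow_right (by norm_num) (by have := P.replaced_le; omega))

lemma drift_le (hP : P.Standard n) {D : ℝ} (hD : 0 ≤ D) {N : ℕ}
    (hN : N * 2 ^ P.samplerLevels ≤ n) {m : ℕ → ℕ}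
    (hm : ∀ h, P.samplerLevels ≤ h → h < P.levels → P.cap h * m h ≤ inflow P N m h) :
    drift P D m ≤ P.s * (n / P.k) + 3 * D * 2 ^ (P.t + 1) := by
  have h1 : (m (P.levels - 1) : ℝ) ≤ 2 ^ (P.t + 1) := by exact_mod_cast hP.batches_le hN hm
  have hk := hP.k_pos
  unfold drift
  refine add_le_add ?_ (by gcongr)
  calc ∑ h ∈ Finset.Ico P.samplerLevels P.levels,
        (if h + P.s < P.H then (0 : ℝ) else 2 ^ h * m h)
      ≤ ∑ h ∈ Finset.Ico P.samplerLevels P.levels,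
          (if h ∈ Finset.Ico (P.H - P.s) P.H then (n / P.k : ℝ) else 0) := by
        refine Finset.sum_le_sum fun h hh => ?_
        obtain ⟨hh1, hh2⟩ := Finset.mem_Ico.1 hh
        have hH : h < P.H := lt_of_lt_of_le hh2 (Nat.sub_le _ _)
        split_ifs with h2 h3 h3
        · positivity
        · exact le_rfl
        · have := hP.two_pow_mul_le_div_cap hN hm hh1 hh2
          rwa [Params.cap, capacity_of_le (by omega)] at this
        · rw [Finset.mem_Ico] at h3
          omega
    _ ≤ ∑ h ∈ Finset.Ico (P.H - P.s) P.H, (n / P.k : ℝ) := by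
        rw [← Finset.sum_filter]
        refine Finset.sum_le_sum_of_subset_of_nonneg (fun h hh => (Finset.mem_filter.1 hh).2)
          fun _ _ _ => by positivity
    _ ≤ P.s * (n / P.k) := by
        rw [Finset.sum_const, Nat.card_Ico, nsmul_eq_mul]
        have : ((P.H - (P.H - P.s) : ℕ) : ℝ) ≤ P.s := by exact_mod_cast (by omega)
        gcongr

/-- The variance decays geometrically in `s`, since `2 c > 1`. -/
lemma variance_le (hP : P.Standard n) {N : ℕ} (hN : N * 2 ^ P.samplerLevels ≤ n) {m : ℕ → ℕ}
    (hm : ∀ h, P.samplerLevels ≤ h → h < P.levels → P.cap h * m h ≤ inflow P N m h) :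
    variance P N m
      ≤ (16 + 4 / (2 * P.c - 1)) * ((n / P.k) ^ 2 * (1 / (2 * P.c)) ^ P.s) := by
  have hk := hP.k_pos
  have hc := hP.c_pos
  have hc2 := hP.half_lt
  set r : ℝ := 1 / (2 * P.c) with hr
  have hr0 : 0 < r := by positivity
  have hr1 : r < 1 := by rw [hr, div_lt_one (by positivity)]; linarith
  have hn0 : (0 : ℝ) ≤ n := by positivity
  have hrpow : ∀ j, (1 / 2 : ℝ) ^ j = r ^ j * P.c ^ j := by
    intro j
    rw [← mul_pow, hr]
    congr 1
    field_simp
  rw [add_mul]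
  refine add_le_add ?_ ?_
  · rcases Nat.eq_zero_or_pos P.samplerLevels with h | h
    · rw [h]
      simp only [pow_zero, sub_self, ne_eq, OfNat.ofNat_ne_zero, not_false_eq_true, zero_pow,
        mul_zero]
      positivity
    · have h1 := hP.samplerLevels_le
      have h2 := hP.lt_s
      have h3 := hP.two_pow_height_mul_le (by omega)
      have hB : (1 : ℝ) ≤ 2 ^ P.samplerLevels := one_le_pow₀ one_le_two
      obtain ⟨j, hj⟩ : ∃ j, P.H = P.samplerLevels + j := ⟨P.H - P.samplerLevels, by omega⟩
      have hjs : P.s ≤ j := by omega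
      -- the last level of the sampler has capacity `2`, which bounds `k`
      have h4 : (P.k : ℝ) * P.c ^ (j + 1) ≤ 2 := by
        have h5 : ¬ 2 < P.cap (P.samplerLevels - 1) :=
          Nat.notMem_of_lt_sInf (s := {h | 2 < P.cap h}) (show P.samplerLevels - 1 < P.samplerLevels by
            omega)
        have h6 := mul_pow_le_capacity (k := P.k) (c := P.c) (s := P.s) (H := P.H)
          (h := P.samplerLevels - 1) (by omega)
        rw [show P.H - (P.samplerLevels - 1) = j + 1 by omega] at h6
        have h7 : (P.cap (P.samplerLevels - 1) : ℝ) ≤ 2 := by exact_mod_cast not_lt.1 h5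
        exact h6.trans h7
      have h5 : P.c ^ j ≤ 4 / P.k := by
        rw [le_div_iff₀ hk]
        rw [pow_succ] at h4
        have : 0 < P.c ^ j * P.k := by positivity
        nlinarith
      have h6 : (2 : ℝ) ^ P.samplerLevels = 2 ^ P.H * (r ^ j * P.c ^ j) := by
        rw [← hrpow, hj, pow_add, mul_assoc, ← mul_pow]
        norm_num
      have h7 : (2 : ℝ) ^ P.H ≤ 4 * n / P.k := by rw [le_div_iff₀ hk]; exact h3
      have h8 : (2 : ℝ) ^ P.samplerLevels ≤ 4 * n / P.k * (r ^ P.s * (4 / P.k)) := by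
        rw [h6]
        have : r ^ j ≤ r ^ P.s := pow_le_pow_of_le_one hr0.le hr1.le hjs
        gcongr
      have h9 : (N : ℝ) * 2 ^ P.samplerLevels ≤ n := by exact_mod_cast hN
      calc (N : ℝ) * (2 ^ P.samplerLevels - 1) ^ 2
          ≤ (N : ℝ) * ((2 : ℝ) ^ P.samplerLevels) ^ 2 := by
            gcongr
            · linarith
        _ = ((N : ℝ) * 2 ^ P.samplerLevels) * 2 ^ P.samplerLevels := by ring
        _ ≤ n * (4 * n / P.k * (r ^ P.s * (4 / P.k))) := by gcongr
        _ = 16 * ((n / P.k) ^ 2 * r ^ P.s) := by field_simp; ring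
  · calc ∑ h ∈ Finset.Ico P.samplerLevels P.levels,
          (if h + P.s < P.H then (m h : ℝ) * ((2 : ℝ) ^ h) ^ 2 else 0)
        ≤ ∑ h ∈ Finset.Ico P.samplerLevels P.levels,
          (if h + P.s < P.H then 4 * (n / P.k : ℝ) ^ 2 * r ^ (P.H - h) else 0) := by
          refine Finset.sum_le_sum fun h hh => ?_
          obtain ⟨hh1, hh2⟩ := Finset.mem_Ico.1 hh
          split_ifs with hlow
          · have h1 := hP.two_pow_mul_le_div_cap hN hm hh1 hh2
            have h2 : (P.k : ℝ) * P.c ^ (P.H - h) ≤ P.cap h := mul_pow_le_capacity hlow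
            have h3 : 0 < (P.k : ℝ) * P.c ^ (P.H - h) := by positivity
            have h4 := hP.two_pow_height_mul_le (by have := hP.lt_s; omega)
            have h5 : (2 : ℝ) ^ P.H ≤ 4 * n / P.k := by rw [le_div_iff₀ hk]; exact h4
            have h6 : (2 : ℝ) ^ h = 2 ^ P.H * (r ^ (P.H - h) * P.c ^ (P.H - h)) := by
              rw [← hrpow]
              conv_rhs => rw [← Nat.add_sub_cancel' (show h ≤ P.H by omega), pow_add, mul_assoc,
                Nat.add_sub_cancel_left, ← mul_pow]
              norm_num
            calc (m h : ℝ) * ((2 : ℝ) ^ h) ^ 2 = (2 ^ h * m h) * 2 ^ h := by ring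
              _ ≤ n / (P.k * P.c ^ (P.H - h)) * 2 ^ h := by
                  gcongr
                  exact h1.trans (by gcongr)
              _ ≤ n / (P.k * P.c ^ (P.H - h))
                    * (4 * n / P.k * (r ^ (P.H - h) * P.c ^ (P.H - h))) := by
                  rw [h6]; gcongr
              _ = 4 * (n / P.k : ℝ) ^ 2 * r ^ (P.H - h) := by field_simp
          · exact le_rfl
      _ ≤ 4 * (n / P.k : ℝ) ^ 2 * (r ^ P.s * (r / (1 - r))) :=
          sum_ite_pow_le P hr0.le hr1 (by positivity)
      _ = 4 / (2 * P.c - 1) * ((n / P.k) ^ 2 * r ^ P.s) := by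
          have h1 : r / (1 - r) = 1 / (2 * P.c - 1) := by
            have : 2 * P.c - 1 ≠ 0 := by linarith
            rw [hr]
            field_simp
          rw [h1]
          ring

/-- The total capacity of the KLL compactors. -/
lemma sum_cap_le (hP : P.Standard n) :
    ((∑ h ∈ Finset.Ico P.samplerLevels P.levels, P.cap h : ℕ) : ℝ)
      ≤ (P.s + 2 / (1 - P.c)) * P.k := by
  have hk := hP.k_pos
  have hc := hP.c_pos
  have hc1 := hP.lt_one
  have hk2 : 2 ≤ P.k := by linarith [hP.four_le]
  have hnonempty : 2 < P.cap P.samplerLevels :=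
    Nat.sInf_mem (s := {h | 2 < P.cap h}) ⟨P.H, by
      have := hP.four_le
      simp only [Set.mem_ofPred_eq, Params.cap]
      rw [capacity_of_le (by omega)]
      omega⟩
  have hmono : Monotone P.cap :=
    monotone_nat_of_le_succ (capacity_mono hc hc1 hP.even hk2)
  push_cast
  calc ∑ h ∈ Finset.Ico P.samplerLevels P.levels, (P.cap h : ℝ)
      ≤ ∑ h ∈ Finset.Ico P.samplerLevels P.levels,
          ((if h ∈ Finset.Ico (P.H - P.s) P.H then (P.k : ℝ) else 0)
            + if h + P.s < P.H then 2 * P.k * P.c ^ (P.H - h) else 0) := by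
        refine Finset.sum_le_sum fun h hh => ?_
        obtain ⟨hh1, hh2⟩ := Finset.mem_Ico.1 hh
        have hH : h < P.H := lt_of_lt_of_le hh2 (Nat.sub_le _ _)
        by_cases hlow : h + P.s < P.H
        · rw [if_pos hlow, if_neg (by rw [Finset.mem_Ico]; omega), zero_add]
          have := capacity_le_two_mul (k := P.k) (c := P.c) hlow (hnonempty.trans_le (hmono hh1))
          rw [mul_assoc]
          exact this
        · rw [if_neg hlow, if_pos (by rw [Finset.mem_Ico]; omega), add_zero, Params.cap,
            capacity_of_le (by omega)]
    _ ≤ P.s * P.k + 2 * P.k * (P.c ^ P.s * (P.c / (1 - P.c))) := by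
        rw [Finset.sum_add_distrib]
        refine add_le_add ?_ (sum_ite_pow_le P hc.le hc1 (by positivity))
        rw [← Finset.sum_filter]
        calc ∑ h ∈ (Finset.Ico P.samplerLevels P.levels).filter
              (fun h => h ∈ Finset.Ico (P.H - P.s) P.H), (P.k : ℝ)
            ≤ ∑ h ∈ Finset.Ico (P.H - P.s) P.H, (P.k : ℝ) :=
              Finset.sum_le_sum_of_subset_of_nonneg (fun h hh => (Finset.mem_filter.1 hh).2)
                fun _ _ _ => hk.le
          _ ≤ P.s * P.k := by
              rw [Finset.sum_const, Nat.card_Ico, nsmul_eq_mul]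
              have : ((P.H - (P.H - P.s) : ℕ) : ℝ) ≤ P.s := by exact_mod_cast (by omega)
              gcongr
    _ ≤ P.s * P.k + 2 * P.k * (1 * (1 / (1 - P.c))) := by
        have h1 : P.c ^ P.s ≤ 1 := pow_le_one₀ hc.le hc1.le
        have h2 : 0 < 1 - P.c := by linarith
        gcongr
    _ = _ := by ring

/-- The space at every time of the run. -/
lemma space_le (hP : P.Standard n) {ws : List ℝ} (hnd : ws.Nodup) (hn : ws.length ≤ n)
    {st : State} (hst : st ∈ (run P ws).support) :
    (space P st : ℝ) ≤ 2 + (P.s + 2 / (1 - P.c) + 2 * P.t) * P.k := by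
  have hA := hP.admissible (D := 8 * (n + 1) / P.k)
    (div_pos (by positivity) hP.k_pos) (by rw [div_mul_cancel₀ _ hP.k_pos.ne']; linarith)
  obtain ⟨x, v, h⟩ := (reaches_run 0 hA 0 hnd hn).of_mem_support hst
  have h1 : (space P st : ℝ) ≤ (2 + ∑ h ∈ Finset.Ico P.samplerLevels P.levels, P.cap h
      + 2 * (P.replaced * P.k) : ℕ) := by exact_mod_cast h.space_le
  have h2 := hP.sum_cap_le
  have h3 : (P.replaced : ℝ) * P.k ≤ P.t * P.k := by
    have : (P.replaced : ℝ) ≤ P.t := by exact_mod_cast P.replaced_le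
    have := hP.k_pos
    gcongr
  push_cast at h1 h2
  linarith

/-- The probability of an error of more than `2 r`, if `r` covers the deterministic errors. -/
lemma measure_error_le (hP : P.Standard n) (hn : 0 < n) {ws : List ℝ} (hnd : ws.Nodup)
    (hws : ws.length = n) (q : ℝ) {r : ℝ} (hr : 0 < r)
    (hdrift : (4 + P.s + 48 * 2 ^ P.t) * (n / P.k) ≤ r) :
    (run P ws).toOuterMeasure {st | ¬ |estimate P st q - rank ws q| ≤ 2 * r}
      ≤ ENNReal.ofReal (2 * Real.exp (-(r ^ 2 / (2 *
          ((16 + 4 / (2 * P.c - 1)) * ((n / P.k) ^ 2 * (1 / (2 * P.c)) ^ P.s)))))) := by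
  have hk := hP.k_pos
  have hc := hP.c_pos
  have hc2 : 0 < 2 * P.c - 1 := by linarith [hP.half_lt]
  have hn' : (0 : ℝ) < n := by exact_mod_cast hn
  have hA := hP.admissible (D := 8 * n / P.k) (by positivity)
    (by rw [div_mul_cancel₀ _ hk.ne'])
  refine Reaches.measure_le (by positivity) hr (reaches_run _ hA q hnd hws.le) ?_
  intro st hst x v hR
  obtain ⟨N, m, h1, h2, rfl, h3⟩ := hR.abs_estimate_sub_le hA.lt
  rw [hws] at h1
  refine ⟨hP.variance_le h1 h2, ?_⟩
  have h4 := hP.drift_le (D := 8 * n / P.k) (by positivity) h1 h2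
  have h5 := hP.two_pow_samplerLevels_sub_one_le
  have h6 : P.s * (n / P.k) + 3 * (8 * n / P.k) * 2 ^ (P.t + 1) + 4 * (n / P.k : ℝ)
      = (4 + P.s + 48 * 2 ^ P.t) * (n / P.k) := by
    rw [pow_succ]
    ring
  rw [Set.mem_ofPred_eq, not_le] at hst
  have h7 := abs_sub_abs_le_abs_sub (estimate P st q - rank ws q) x
  linarith

end Params.Standard
end

lemma one_le_logLog (δ : ℝ) : 1 ≤ logLog δ := le_max_left _ _

lemma log_le_exp_logLog {δ : ℝ} (h0 : 0 < δ) (h1 : δ < 1) :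
    Real.log (1 / δ) ≤ Real.exp (logLog δ) := by
  have h : 0 < Real.log (1 / δ) := Real.log_pos (by rw [lt_div_iff₀ h0]; linarith)
  calc Real.log (1 / δ) = Real.exp (Real.log (Real.log (1 / δ))) := (Real.exp_log h).symm
    _ ≤ _ := Real.exp_le_exp.2 (le_max_right _ _)

lemma two_mul_exp_neg_le {δ z : ℝ} (h0 : 0 < δ) (h1 : δ < 1) (hz : 2 * Real.exp (logLog δ) ≤ z) :
    2 * Real.exp (-z) ≤ δ := by
  have h2 := log_le_exp_logLog h0 h1
  have h3 : Real.log 2 ≤ Real.exp (logLog δ) := by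
    have h4 := Real.log_two_lt_d9
    have h5 := Real.add_one_le_exp (logLog δ)
    have h6 := one_le_logLog δ
    linarith
  calc 2 * Real.exp (-z) ≤ 2 * Real.exp (-(Real.log 2 + Real.log (1 / δ))) := by
        gcongr; linarith
    _ = δ := by
        rw [neg_add, Real.exp_add, Real.exp_neg, Real.exp_log two_pos, one_div, Real.log_inv,
          neg_neg, Real.exp_log h0]
        field_simp

/-- The exponent of the tail bound is large enough: `(2 c) ^ s` is at least `exp l`, and `ε k` is at
least `2 K l`. -/
lemma two_mul_exp_le_exponent {A K Cv c ε l n k : ℝ} {s : ℕ} (hc : 1 / 2 < c) (hl : 1 ≤ l)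
    (hA : 1 ≤ Real.log (2 * c) * A) (hs : A * l ≤ s) (hCv : 0 < Cv) (hK : 1 ≤ K) (hKC : 4 * Cv ≤ K)
    (hn : 0 < n) (hk : 0 < k) (hk' : 2 * K * l ≤ ε * k) :
    2 * Real.exp l
      ≤ (ε * n / 2) ^ 2 / (2 * (Cv * ((n / k) ^ 2 * (1 / (2 * c)) ^ s))) := by
  have hc0 : 0 < c := by linarith
  have hlog : 0 < Real.log (2 * c) := Real.log_pos (by linarith)
  have h2 : Real.exp l ≤ (2 * c) ^ s := by
    rw [← Real.rpow_natCast, Real.rpow_def_of_pos (by positivity)]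
    refine Real.exp_le_exp.2 ?_
    calc l ≤ Real.log (2 * c) * A * l := le_mul_of_one_le_left (by linarith) hA
      _ = Real.log (2 * c) * (A * l) := by ring
      _ ≤ _ := by gcongr
  have h3 : (ε * n / 2) ^ 2 / (2 * (Cv * ((n / k) ^ 2 * (1 / (2 * c)) ^ s)))
      = (ε * k) ^ 2 * (2 * c) ^ s / (8 * Cv) := by
    rw [one_div, inv_pow]
    field_simp
    ring
  have h4 : 2 * K ≤ ε * k := by
    have : 2 * K * 1 ≤ 2 * K * l := by gcongr
    linarith
  rw [h3, le_div_iff₀ (by positivity)]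
  have h5 : 16 * Cv ≤ (ε * k) ^ 2 := by
    have h6 : (2 * K) ^ 2 ≤ (ε * k) ^ 2 := by gcongr
    have h7 : K * 1 ≤ K * K := by gcongr
    linarith
  calc 2 * Real.exp l * (8 * Cv) = 16 * Cv * Real.exp l := by ring
    _ ≤ (ε * k) ^ 2 * (2 * c) ^ s := by gcongr

lemma ofReal_one_sub_le_of_compl {α : Type*} (p : PMF α) (s : Set α) {δ : ℝ} (hδ : 0 ≤ δ)
    (h : p.toOuterMeasure sᶜ ≤ ENNReal.ofReal δ) : ENNReal.ofReal (1 - δ) ≤ p.toOuterMeasure s := by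
  rw [ENNReal.ofReal_sub _ hδ, ENNReal.ofReal_one, tsub_le_iff_right]
  have h1 : p.toOuterMeasure Set.univ = 1 :=
    (p.toOuterMeasure_apply_eq_one_iff Set.univ).2 (Set.subset_univ _)
  calc 1 = p.toOuterMeasure (s ∪ sᶜ) := by rw [Set.union_compl_self, h1]
    _ ≤ p.toOuterMeasure s + p.toOuterMeasure sᶜ := MeasureTheory.measure_union_le _ _
    _ ≤ _ := by gcongr

end LinearSketch

end

theorem mainTheorem1 (t : ℕ) (c : ℝ) (hc : 1 / 2 < c) (hc' : c < 1) :
    ∃ A K M : ℝ, 0 < A ∧ 0 < K ∧ 0 < M ∧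
      ∀ (compact : List (ℝ × ℝ) → List (ℝ × ℝ)), LinearSketch.IsOptimalRule compact →
      ∀ (ε δ : ℝ), 0 < ε → ε < 1 → 0 < δ → δ < 1 →
      ∀ (xs : List ℝ), xs.Nodup →
        (∀ q : ℝ, ENNReal.ofReal (1 - δ) ≤
          (LinearSketch.run
            (LinearSketch.sketchParams A K c t compact ε δ xs.length) xs).toOuterMeasure
            {st | |LinearSketch.estimate
                (LinearSketch.sketchParams A K c t compact ε δ xs.length) st q
                - (LinearSketch.rank xs q : ℝ)| ≤ ε * (xs.length : ℝ)}) ∧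
        (∀ i ≤ xs.length, ∀ st ∈ (LinearSketch.run
            (LinearSketch.sketchParams A K c t compact ε δ xs.length) (xs.take i)).support,
          (LinearSketch.space
            (LinearSketch.sketchParams A K c t compact ε δ xs.length) st : ℝ)
            ≤ M * (1 / ε) * LinearSketch.logLog δ ^ 2) := by
  have hc0 : 0 < c := by linarith
  have hlog : 0 < Real.log (2 * c) := Real.log_pos (by linarith)
  have hc2 : 0 < 2 * c - 1 := by linarith
  have hc1 : 0 < 1 - c := by linarith
  set A : ℝ := t + 1 + 1 / Real.log (2 * c) with hA
  have hA0 : 0 < A := by positivity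
  set Cv : ℝ := 16 + 4 / (2 * c - 1) with hCv
  have hCv0 : 0 < Cv := by positivity
  set K : ℝ := A + 5 + 48 * 2 ^ t + 4 * Cv with hK
  have hK0 : 0 < K := by positivity
  have h48 : (0 : ℝ) ≤ 48 * 2 ^ t := by positivity
  have hK5 : 5 ≤ K := by linarith
  have hKA : A + 5 + 48 * 2 ^ t ≤ K := by linarith
  have hKC : 4 * Cv ≤ K := by linarith
  have hAt : t + 1 ≤ A := by
    have : 0 < 1 / Real.log (2 * c) := by positivity
    linarith
  have hAlog : 1 ≤ Real.log (2 * c) * A := by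
    rw [hA, mul_add, mul_one_div_cancel hlog.ne']
    have : 0 ≤ Real.log (2 * c) * (t + 1) := by positivity
    linarith
  clear_value K A Cv
  refine ⟨A, K, 2 + (A + 1 + 2 / (1 - c) + 2 * t) * (2 * (K + 1)), hA0, hK0, by positivity, ?_⟩
  intro compact hcompact ε δ hε hε1 hδ hδ1 xs hxs
  set n := xs.length with hn
  set P := LinearSketch.sketchParams A K c t compact ε δ n with hP
  set l := LinearSketch.logLog δ with hl
  have hl1 : 1 ≤ l := LinearSketch.one_le_logLog δ
  have hPk : P.k = 2 * ⌈K * l / ε⌉₊ := rfl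
  have hPs : P.s = ⌈A * l⌉₊ := rfl
  have hPc : P.c = c := rfl
  have hPt : P.t = t := rfl
  have hle : l ≤ l / ε := by rw [le_div_iff₀ hε]; nlinarith
  have hk1 : 2 * (K * l / ε) ≤ P.k := by
    rw [hPk]
    have := Nat.le_ceil (K * l / ε)
    push_cast
    linarith
  have hk2 : (P.k : ℝ) ≤ 2 * (K + 1) * (l / ε) := by
    rw [hPk]
    have := Nat.ceil_lt_add_one (a := K * l / ε) (by positivity)
    push_cast
    rw [mul_div_assoc] at this ⊢
    nlinarith
  have hs1 : A * l ≤ P.s := Nat.le_ceil _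
  have hs2 : (P.s : ℝ) ≤ (A + 1) * l := by
    have := Nat.ceil_lt_add_one (a := A * l) (by positivity)
    rw [hPs]
    linarith
  have hstd : P.Standard n :=
    { rule := hcompact
      half_lt := hc
      lt_one := hc'
      even := by rw [hPk]; omega
      four_le := by
        have h1 : 1 < ⌈K * l / ε⌉₊ := by
          refine Nat.lt_ceil.2 ?_
          rw [mul_div_assoc]
          push_cast
          nlinarith
        rw [hPk]
        omega
      lt_s := by
        have h1 : (t : ℝ) < P.s := by
          have : A ≤ A * l := le_mul_of_one_le_right hA0.le hl1
          linarith
        rw [hPt]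
        exact_mod_cast h1
      height := rfl }
  have hk0 := hstd.k_pos
  refine ⟨fun q => ?_, fun i hi st hst => ?_⟩
  · rcases Nat.eq_zero_or_pos n with hn0 | hn0
    · have hnil : xs = [] := List.length_eq_zero_iff.1 (hn.symm.trans hn0)
      have hmem : LinearSketch.State.init ∈ {st | |LinearSketch.estimate P st q
          - (LinearSketch.rank xs q : ℝ)| ≤ ε * (n : ℝ)} := by
        rw [Set.mem_ofPred_eq, hnil, hn0]
        simp [LinearSketch.estimate, LinearSketch.State.init, LinearSketch.rank,
          LinearSketch.linRank]
      have hrun : LinearSketch.run P xs = PMF.pure LinearSketch.State.init := by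
        rw [hnil]; rfl
      rw [hrun, PMF.toOuterMeasure_pure_apply, if_pos hmem]
      exact ENNReal.ofReal_le_one.2 (by linarith)
    · have hn' : (0 : ℝ) < n := by exact_mod_cast hn0
      have hdrift : (4 + P.s + 48 * 2 ^ P.t) * (n / P.k) ≤ ε * n / 2 := by
        have h1 : (4 + P.s + 48 * 2 ^ P.t : ℝ) ≤ K * l := by
          rw [hPt]
          have h2 : (A + 5 + 48 * 2 ^ t) * l ≤ K * l := by gcongr
          have h3 : 48 * 2 ^ t ≤ 48 * 2 ^ t * l := le_mul_of_one_le_right h48 hl1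
          linarith
        have h2 : 2 * (K * l) ≤ ε * P.k := by
          have := mul_le_mul_of_nonneg_left hk1 hε.le
          rw [show ε * (2 * (K * l / ε)) = 2 * (K * l) by field_simp] at this
          exact this
        rw [← mul_div_assoc, div_le_iff₀ hk0]
        nlinarith
      have h1 := hstd.measure_error_le hn0 hxs rfl q (r := ε * n / 2) (by positivity) hdrift
      refine LinearSketch.ofReal_one_sub_le_of_compl _ _ hδ.le ?_
      rw [show 2 * (ε * n / 2) = ε * n by ring] at h1
      refine h1.trans (ENNReal.ofReal_le_ofReal (LinearSketch.two_mul_exp_neg_le hδ hδ1 ?_))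
      rw [hPc, ← hCv, ← hl]
      have h2 : 2 * K * l ≤ ε * P.k := by
        have := mul_le_mul_of_nonneg_left hk1 hε.le
        rw [show ε * (2 * (K * l / ε)) = 2 * K * l by field_simp] at this
        exact this
      exact LinearSketch.two_mul_exp_le_exponent hc hl1 hAlog hs1 hCv0 (by linarith) hKC hn' hk0 h2
  · have h1 := hstd.space_le (hxs.sublist (List.take_sublist i xs))
      (by rw [List.length_take]; exact min_le_right _ _) hst
    rw [hPc, hPt] at h1
    have h2 : (P.s + 2 / (1 - c) + 2 * t : ℝ) ≤ (A + 1 + 2 / (1 - c) + 2 * t) * l := by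
      have h3 : 0 ≤ 2 / (1 - c) + 2 * (t : ℝ) := by positivity
      nlinarith
    calc (LinearSketch.space P st : ℝ) ≤ 2 + (P.s + 2 / (1 - c) + 2 * t) * P.k := h1
      _ ≤ 2 * (l * (l / ε)) + (A + 1 + 2 / (1 - c) + 2 * t) * l * (2 * (K + 1) * (l / ε)) := by
          have : 1 ≤ l * (l / ε) := by nlinarith
          gcongr
          linarith
      _ = _ := by ring
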